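/- Let $d,n\ge 1$ be integers and $C,R>0$. Let $\mathbb B$ and $\mathbb S$ be the closed unit ball and the unit sphere of $\mathbb R^d$. We consider a closed convex set $S\subseteq R\,\mathbb B\subset\mathbb R^d$, an affine bijection $T$ of $\mathbb R^d$ that puts $S$ into near-isotropic position, i.e. $\mathbb B\subseteq T(S)\subseteq 1.01\,d\,\mathbb B$, and convex functions $c_1,\dots,c_n\colon S\to[-C,C]$ fixed in advance. Bandit gradient descent (BGD) with parameters $\nu,\delta,\alpha$ is run on $T(S)$ with the costs $c_t\circ T^{-1}$: let $u_1,u_2,\dots$ be independent and uniformly distributed on $\mathbb S$, put $y_1=0$, and for each $t$ let $$x_t'=y_t+\delta u_t,\qquad x_t=T^{-1}(x_t'),\qquad y_{t+1}=P_{(1-\alpha)T(S)}\bigl(y_t-\nu\,c_t(x_t)\,u_t\bigr),$$ where $P_K(x)$ is the point of $K$ nearest to $x$. The expected regret is $\mathbf E\bigl[\sum_{t=1}^n c_t(x_t)\bigr]-\inf_{x\in S}\sum_{t=1}^n c_t(x)$. (a) Lipschitz costs. For every $L\ge 0$ there are $\nu,\delta>0$ and $\alpha\in[0,1]$, depending only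 on $d,n,C,R,L$, such that for all $S,T,c_1,\dots,c_n$ as above with every $c_t$ $L$-Lipschitz on $S$, BGD only plays points $x_1,\dots,x_n$ of $S$, the costs $c_t(x_t)$ are integrable, and the expected regret is at most $$6\,n^{3/4}\,d\,\bigl(\sqrt{CLR}+C\bigr).$$ If $n\ge\Bigl(\frac{1.01\,d^2C}{3(LR+C)}\Bigr)^2$, this holds with $\nu=\frac{1.01\,d}{C\sqrt n}$ and $\alpha=\delta=n^{-1/4}\sqrt{\frac{1.01\,d^2C}{3(LR+C)}}$. (b) Without the Lipschitz assumption. There are $\nu,\delta>0$ and $\alpha\in[0,1]$, depending only on $d,n,C,R$, such that for all $S,T,c_1,\dots,c_n$ as above BGD only plays points $x_1,\dots,x_n$ of $S$, the costs $c_t(x_t)$ are integrable, and the expected regret is at most $$6\,n^{5/6}\,d\,C.$$ If $n\ge\bigl(\tfrac{3\cdot 1.01\,d^2}{2}\bigr)^2$, this holds with $\nu=\frac{1.01\,d}{C\sqrt n}$, $\delta=\sqrt[3]{\frac{(1.01\,d)^2d^2}{12\,n}}$ and $\alpha=\sqrt[3]{\frac{3\cdot 1.01\,d^2}{2\sqrt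 n}}$. -/

import Mathlib

open MeasureTheory ProbabilityTheory Metric Set
open scoped Pointwise NNReal

/-- `d`-dimensional Euclidean space. -/
abbrev Euc (d : ℕ) : Type := EuclideanSpace ℝ (Fin d)

/-- The unit sphere of `Euc d`, as a type. -/
abbrev UnitSphere (d : ℕ) : Type := sphere (0 : Euc d) 1

/-- The uniform probability measure on the unit sphere: normalized surface measure. -/
noncomputable def uniformSphere (d : ℕ) : Measure (UnitSphere d) :=
  ((volume : Measure (Euc d)).toSphere univ)⁻¹ • (volume : Measure (Euc d)).toSphere

/-- `p` is a point of `K` nearest to `x`. -/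
def IsNearestPoint {d : ℕ} (K : Set (Euc d)) (x p : Euc d) : Prop :=
  p ∈ K ∧ ∀ z ∈ K, ‖x - p‖ ≤ ‖x - z‖

open Classical in
/-- The projection of `x` onto `K`, that is, the point of `K` nearest to `x`
(unique when `K` is convex; the value is irrelevant when there is no nearest point). -/
noncomputable def nearestPoint {d : ℕ} (K : Set (Euc d)) (x : Euc d) : Euc d :=
  if h : ∃ p, IsNearestPoint K x p then h.choose else x

/-- On nonempty closed sets the projection is a nearest point. -/
theorem nearestPoint_spec {d : ℕ} {K : Set (Euc d)} (hK : IsClosed K) (hne : K.Nonempty)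
    (x : Euc d) : IsNearestPoint K x (nearestPoint K x) := by
  have h : ∃ p, IsNearestPoint K x p := by
    obtain ⟨p, hp, hd⟩ := hK.exists_infDist_eq_dist hne x
    refine ⟨p, hp, fun z hz => ?_⟩
    rw [← dist_eq_norm, ← dist_eq_norm, ← hd]
    exact infDist_le_dist_of_mem hz
  unfold nearestPoint
  rw [dif_pos h]
  exact h.choose_spec

/-- The centres `y_t` of bandit gradient descent with step `ν`, perturbation radius `δ` and
shrinkage `α`, on the feasible set `K`, with cost functions `c t` and random directions `u t`
(periods are numbered from `0`):
`y_0 = 0` and `y_{t+1}` is the projection onto `(1 - α) K` of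
`y_t - ν c_t(y_t + δ u_t) u_t`. -/
noncomputable def bgdCentre {d : ℕ} (K : Set (Euc d)) (c : ℕ → Euc d → ℝ) (ν δ α : ℝ)
    (u : ℕ → UnitSphere d) : ℕ → Euc d
  | 0 => 0
  | t + 1 =>
      nearestPoint ((1 - α) • K)
        (bgdCentre K c ν δ α u t -
          (ν * c t (bgdCentre K c ν δ α u t + δ • (u t : Euc d))) • (u t : Euc d))

/-- The point `x_t = y_t + δ u_t` played by bandit gradient descent in period `t`. -/
noncomputable def bgdPoint {d : ℕ} (K : Set (Euc d)) (c : ℕ → Euc d → ℝ) (ν δ α : ℝ)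
    (u : ℕ → UnitSphere d) (t : ℕ) : Euc d :=
  bgdCentre K c ν δ α u t + δ • (u t : Euc d)

/-- The affine bijection `T` puts `S` into near-isotropic position:
`B ⊆ T(S) ⊆ 1.01 d B`, with `B` the closed unit ball. -/
def IsNearIsotropic {d : ℕ} (T : Euc d ≃ᵃ[ℝ] Euc d) (S : Set (Euc d)) : Prop :=
  closedBall 0 1 ⊆ T '' S ∧ T '' S ⊆ closedBall 0 (1.01 * (d : ℝ))

/-- The point of `S` played in period `t` after reshaping by `T`: bandit gradient descent is run
on `T(S)` with the costs `c_t ∘ T⁻¹`, and its points are mapped back by `T⁻¹`. -/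
noncomputable def reshapedPoint {d : ℕ} (T : Euc d ≃ᵃ[ℝ] Euc d) (S : Set (Euc d))
    (c : ℕ → Euc d → ℝ) (ν δ α : ℝ) (u : ℕ → UnitSphere d) (t : ℕ) : Euc d :=
  T.symm (bgdPoint (T '' S) (fun s z => c s (T.symm z)) ν δ α u t)

/-- The expected regret over `n` periods of the random points `x t`, relative to the best fixed
point of `S`: `E[∑ c_t(x_t)] - inf_{z ∈ S} ∑ c_t(z)`. -/
noncomputable def expectedRegret {d : ℕ} {Ω : Type*} [MeasurableSpace Ω] (μ : Measure Ω)
    (S : Set (Euc d)) (n : ℕ) (c : ℕ → Euc d → ℝ) (x : ℕ → Ω → Euc d) : ℝ :=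
  (∫ ω, ∑ t ∈ Finset.range n, c t (x t ω) ∂μ) -
    sInf ((fun z => ∑ t ∈ Finset.range n, c t z) '' S)

/-- The directions `u t` are independent and uniformly distributed on the unit sphere. -/
structure IsUniformDirections {d : ℕ} {Ω : Type*} [MeasurableSpace Ω] (μ : Measure Ω)
    (u : ℕ → Ω → UnitSphere d) : Prop where
  measurable : ∀ t, Measurable (u t)
  law : ∀ t, μ.map (u t) = uniformSphere d
  indep : iIndepFun u μ

/-- An admissible instance of the problem: `S` is a closed convex subset of the ball of
radius `R`, the map `T` puts `S` into near-isotropic position, and the first `n` costs are convex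
functions from `S` to `[-C, C]`. -/
structure IsInstance {d : ℕ} (n : ℕ) (C R : ℝ) (S : Set (Euc d)) (T : Euc d ≃ᵃ[ℝ] Euc d)
    (c : ℕ → Euc d → ℝ) : Prop where
  closed : IsClosed S
  convex : Convex ℝ S
  subset_ball : S ⊆ closedBall 0 R
  nearIsotropic : IsNearIsotropic T S
  cost_convex : ∀ t < n, ConvexOn ℝ S (c t)
  cost_bounded : ∀ t < n, ∀ x ∈ S, c t x ∈ Icc (-C) C

/-- Bandit gradient descent, reshaped by `T` and run with independent uniform directions `u`,
plays in `S` only, its costs are integrable, and its expected regret over `n` periods is at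
most `b`. -/
def HasRegretBound {d : ℕ} {Ω : Type*} [MeasurableSpace Ω] (μ : Measure Ω)
    (u : ℕ → Ω → UnitSphere d) (n : ℕ) (S : Set (Euc d)) (T : Euc d ≃ᵃ[ℝ] Euc d)
    (c : ℕ → Euc d → ℝ) (ν δ α b : ℝ) : Prop :=
  (∀ t < n, ∀ ω, reshapedPoint T S c ν δ α (fun s => u s ω) t ∈ S) ∧
  (∀ t < n, Integrable (fun ω => c t (reshapedPoint T S c ν δ α (fun s => u s ω) t)) μ) ∧
  expectedRegret μ S n c (fun t ω => reshapedPoint T S c ν δ α (fun s => u s ω) t) ≤ b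

/-! The heart is a one-point gradient inequality. If `f` is convex, `u` is uniform on the sphere and
`M` bounds `f` on the ball of radius `δ` around `z`, then `(d / δ) E[f (y + δ u) ⟪u, z - y⟫] ≤ M - f
y` (`integral_uniformSphere_mul_inner_le`). So the single observed value `f (y + δ u)` times `u`
serves as a subgradient at `y`. No smoothed cost has to be differentiated. After rescaling to the
unit ball, translate a smooth even radial cutoff `φ` of that ball by `s • w` and pair it with the
cost `h`. Convexity along the segments from `x` to `x + w` bounds the derivative of the pairing at
`s = 0` by `M ∫ φ` minus the pairing at `s = 0`, and midpoint convexity bounds that pairing below by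
`h 0 ∫ φ` (`neg_integral_mul_fderiv_le`). As `φ` tends to the indicator of the ball, its derivative
concentrates on the sphere (`integral_sphere_mul_inner_le`).

For each outcome, the potential `‖y_t - z‖ ^ 2` gives the usual regret bound of projected gradient
descent (`sum_mul_inner_le`). The centre `y_t` depends only on the earlier directions, so it is
independent of `u_t`; freezing it brings in the gradient inequality (`integral_cost_point_le`). With
`D = 1.01 d`, the regret is at most `n (2 α C + B) + (d / δ) (D ^ 2 + n ν ^ 2 C ^ 2) / (2 ν)`. Here
`2 α C` pays for shrinking the comparator and `B` for the perturbation: `δ L R` for Lipschitz costs,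
`2 C δ / α` in general. The parameters balance these terms. When `n` is too small for them, the
trivial bound `2 n C` suffices. -/

/-! ### Convex functions tested against translated even weights -/

section Variation

open Filter Topology

variable {E : Type*} [NormedAddCommGroup E] [NormedSpace ℝ E] [FiniteDimensional ℝ E]
  [MeasurableSpace E] [BorelSpace E]

/-- Testing a convex function against an even weight supported in the unit ball: the pairing with
minus the derivative of the weight in direction `w` is at most the weighted difference between a
bound on the unit ball around `w` and the value at the centre. -/
theorem neg_integral_mul_fderiv_le (μ : Measure E) [μ.IsAddHaarMeasure] {h φ : E → ℝ} {Q : Set E}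
    {w : E} {M ρ : ℝ} (hh : ConvexOn ℝ Q h) (hB : closedBall 0 1 ⊆ Q) (hBw : closedBall w 1 ⊆ Q)
    (hM : ∀ v ∈ closedBall w 1, h v ≤ M) (hint : IntegrableOn h (closedBall 0 1) μ)
    (hφ : ContDiff ℝ 1 φ) (hφe : ∀ x, φ (-x) = φ x) (hφ0 : ∀ x, 0 ≤ φ x) (hρ : ρ < 1)
    (hsupp : ∀ x, ρ ≤ ‖x‖ → φ x = 0) :
    -∫ x in closedBall 0 1, h x * fderiv ℝ φ x w ∂μ ≤ (M - h 0) * ∫ x, φ x ∂μ := by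
  set h' : E → ℝ := (closedBall 0 1).indicator h with hh'
  have hint' : Integrable h' μ := (integrable_indicator_iff measurableSet_closedBall).2 hint
  have hcs : HasCompactSupport φ := by
    refine HasCompactSupport.intro (isCompact_closedBall (0 : E) ρ) fun x hx => hsupp x ?_
    simp only [mem_closedBall, dist_zero_right, not_le] at hx
    exact hx.le
  have hφd : Differentiable ℝ φ := hφ.differentiable one_ne_zero
  have hφ'c : Continuous (fderiv ℝ φ) := hφ.continuous_fderiv one_ne_zero
  obtain ⟨C₀, hC₀⟩ := hcs.exists_bound_of_continuous hφ.continuous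
  obtain ⟨C₁, hC₁⟩ := (hcs.fderiv ℝ).exists_bound_of_continuous hφ'c
  have hφi : Integrable φ μ := hφ.continuous.integrable_of_hasCompactSupport hcs
  have hmulint : ∀ a : E, Integrable (fun x => h' x * φ (x - a)) μ := fun a =>
    hint'.mul_bdd (c := C₀) (by fun_prop) (Eventually.of_forall fun x => hC₀ _)
  have hmulint' : ∀ a : E, Integrable (fun x => h' (x + a) * φ x) μ := fun a =>
    (hint'.comp_add_right a).mul_bdd (c := C₀) (by fun_prop) (Eventually.of_forall fun x => hC₀ _)
  set J : ℝ → ℝ := fun s => ∫ x, h' x * φ (x - s • w) ∂μ with hJ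
  have hJ0 : J 0 = ∫ x, h' x * φ x ∂μ := by simp [hJ]
  -- The translation acts on `φ` alone, so differentiating under the integral needs only
  -- integrability of `h`.
  have hderiv : HasDerivAt J (-∫ x in closedBall 0 1, h x * fderiv ℝ φ x w ∂μ) 0 := by
    have key := (hasDerivAt_integral_of_dominated_loc_of_deriv_le (μ := μ) (𝕜 := ℝ)
      (F := fun s x => h' x * φ (x - s • w)) (x₀ := 0) (s := univ)
      (F' := fun s x => h' x * fderiv ℝ φ (x - s • w) (-w)) (bound := fun x => ‖h' x‖ * (C₁ * ‖w‖))
      univ_mem (Eventually.of_forall fun s => (hmulint _).1) (hmulint _) ?_ ?_ ?_ ?_).2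
    · have e : (∫ x, h' x * fderiv ℝ φ (x - (0 : ℝ) • w) (-w) ∂μ)
          = -∫ x in closedBall 0 1, h x * fderiv ℝ φ x w ∂μ := by
        rw [← integral_neg, ← integral_indicator measurableSet_closedBall]
        refine integral_congr_ae (Eventually.of_forall fun x => ?_)
        by_cases hx : x ∈ closedBall (0 : E) 1
        · simp [hh', hx]
        · simp [hh', hx]
      rw [← e]
      exact key
    · exact (hint'.1.mul (Continuous.aestronglyMeasurable (by fun_prop)))
    · refine Eventually.of_forall fun x s _ => ?_
      rw [norm_mul]
      gcongr
      refine (ContinuousLinearMap.le_opNorm _ _).trans ?_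
      rw [norm_neg]
      gcongr
      exact hC₁ _
    · exact hint'.norm.mul_const _
    · refine Eventually.of_forall fun x s _ => ?_
      have h1 : HasDerivAt (fun s : ℝ => x - s • w) (-w) s := by
        simpa using ((hasDerivAt_id s).smul_const w).const_sub x
      exact ((hφd _).hasFDerivAt.comp_hasDerivAt s h1).const_mul _
  -- Once `s * ‖w‖ < 1 - ρ`, the support of `φ` shifted by `s • w` stays in the unit ball, where
  -- `h'` equals `h`. Convexity then gives `h (x + s w) ≤ (1 - s) h x + s M`.
  have hstep : ∀ᶠ s in 𝓝[>] (0 : ℝ), (J s - J 0) / s ≤ M * (∫ x, φ x ∂μ) - J 0 := by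
    have hsm : ∀ᶠ s in 𝓝[>] (0 : ℝ), s * ‖w‖ < 1 - ρ := by
      have : Tendsto (fun s : ℝ => s * ‖w‖) (𝓝[>] 0) (𝓝 (0 * ‖w‖)) :=
        ((continuous_id.mul continuous_const).tendsto 0).mono_left nhdsWithin_le_nhds
      exact this.eventually (gt_mem_nhds (by linarith))
    have hlt : ∀ᶠ s in 𝓝[>] (0 : ℝ), s < 1 :=
      nhdsWithin_le_nhds (gt_mem_nhds one_pos)
    filter_upwards [hsm, hlt, self_mem_nhdsWithin] with s hs hs1 hs0
    have hs0 : 0 < s := hs0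
    have e1 : J s = ∫ x, h' (x + s • w) * φ x ∂μ := by
      refine (integral_add_right_eq_self (μ := μ) (fun x => h' x * φ (x - s • w))
        (s • w)).symm.trans ?_
      simp
    have e2 : J s ≤ ∫ x, ((1 - s) * (h' x * φ x) + s * (M * φ x)) ∂μ := by
      rw [e1]
      refine integral_mono (hmulint' _)
        ((((hmulint 0).congr (by simp)).const_mul _).add ((hφi.const_mul _).const_mul _)) fun x => ?_
      show h' (x + s • w) * φ x ≤ (1 - s) * (h' x * φ x) + s * (M * φ x)
      by_cases hx : ρ ≤ ‖x‖
      · simp [hsupp x hx]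
      · push Not at hx
        have hx1 : x ∈ closedBall (0 : E) 1 := by simpa using (hx.trans hρ).le
        have hxs : x + s • w ∈ closedBall (0 : E) 1 := by
          have := norm_add_le x (s • w)
          rw [norm_smul, Real.norm_of_nonneg hs0.le] at this
          simpa using this.trans (by linarith)
        have hxw : x + w ∈ closedBall w 1 := by simpa using hx1
        have hc := hh.2 (hB hx1) (hBw hxw) (sub_nonneg.2 hs1.le) hs0.le (by ring)
        have e3 : (1 - s) • x + s • (x + w) = x + s • w := by module
        rw [e3, smul_eq_mul, smul_eq_mul] at hc
        have := mul_le_mul_of_nonneg_left (hM _ hxw) hs0.le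
        simp only [hh', indicator_of_mem hx1, indicator_of_mem hxs]
        have := mul_le_mul_of_nonneg_right (hc.trans (add_le_add_right this _)) (hφ0 x)
        linarith
    rw [integral_add (((hmulint 0).congr (by simp)).const_mul _) ((hφi.const_mul _).const_mul _),
      integral_const_mul, integral_const_mul, integral_const_mul, ← hJ0] at e2
    rw [div_le_iff₀ hs0]
    linarith
  have hJ' : -∫ x in closedBall 0 1, h x * fderiv ℝ φ x w ∂μ ≤ M * (∫ x, φ x ∂μ) - J 0 := by
    have ht := (hasDerivAt_iff_tendsto_slope.1 hderiv).mono_left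
      (nhdsWithin_mono 0 (fun s (hs : 0 < s) => (ne_of_gt hs : s ≠ 0)) :
        𝓝[>] (0 : ℝ) ≤ 𝓝[≠] 0)
    refine le_of_tendsto ht ?_
    filter_upwards [hstep] with s hs
    rw [slope_def_field, sub_zero]
    exact hs
  -- As `φ` is even, `h` may be replaced by the average of `h x` and `h (-x)`, which is at least `h
  -- 0`.
  have hJ0' : h 0 * (∫ x, φ x ∂μ) ≤ J 0 := by
    have e1 : J 0 = ∫ x, h' (-x) * φ x ∂μ := by
      rw [hJ0, ← integral_neg_eq_self]
      simp [hφe]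
    have e2 : 2 * J 0 = ∫ x, (h' x * φ x + h' (-x) * φ x) ∂μ := by
      rw [integral_add, ← hJ0, ← e1, two_mul]
      · exact (hmulint 0).congr (by simp)
      · have := (((hmulint 0).congr (g := fun x => h' x * φ x) (by simp)).comp_neg)
        exact this.congr (by simp [hφe])
    have e3 : (2 * h 0) * (∫ x, φ x ∂μ) ≤ 2 * J 0 := by
      rw [e2, ← integral_const_mul]
      refine integral_mono (hφi.const_mul _) ?_ fun x => ?_
      · refine Integrable.add ((hmulint 0).congr (by simp)) ?_
        have := (((hmulint 0).congr (g := fun x => h' x * φ x) (by simp)).comp_neg)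
        exact this.congr (by simp [hφe])
      · show 2 * h 0 * φ x ≤ h' x * φ x + h' (-x) * φ x
        by_cases hx : ρ ≤ ‖x‖
        · simp [hsupp x hx]
        · push Not at hx
          have hx1 : x ∈ closedBall (0 : E) 1 := by simpa using (hx.trans hρ).le
          have hx2 : -x ∈ closedBall (0 : E) 1 := by simpa using (hx.trans hρ).le
          have hc := hh.2 (hB hx1) (hB hx2) (by norm_num : (0 : ℝ) ≤ 1 / 2)
            (by norm_num : (0 : ℝ) ≤ 1 / 2) (by norm_num)
          have e4 : (1 / 2 : ℝ) • x + (1 / 2 : ℝ) • (-x) = 0 := by module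
          rw [e4, smul_eq_mul, smul_eq_mul] at hc
          simp only [hh', indicator_of_mem hx1, indicator_of_mem hx2]
          have := mul_le_mul_of_nonneg_right hc (hφ0 x)
          linarith
    linarith
  linarith

end Variation

/-! ### Polar coordinates and radial concentration on the sphere -/

section Polar

open Filter Topology Module

variable {E : Type*} [NormedAddCommGroup E] [NormedSpace ℝ E] [FiniteDimensional ℝ E]
  [MeasurableSpace E] [BorelSpace E] [Nontrivial E]

/-- Polar coordinates for the product of a function of the direction and one of the norm. -/
theorem integral_direction_mul_norm (μ : Measure E) [μ.IsAddHaarMeasure] (G : E → ℝ) (k : ℝ → ℝ) :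
    ∫ x, G (‖x‖⁻¹ • x) * k ‖x‖ ∂μ =
      (∫ u : sphere (0 : E) 1, G u ∂μ.toSphere) *
        ∫ r in Ioi (0 : ℝ), r ^ (finrank ℝ E - 1) * k r :=
  calc
    ∫ x, G (‖x‖⁻¹ • x) * k ‖x‖ ∂μ
      = ∫ x : ({(0 : E)}ᶜ : Set E), G (‖x.1‖⁻¹ • x.1) * k ‖x.1‖ ∂(μ.comap (↑)) := by
      rw [integral_subtype_comap (measurableSet_singleton _).compl
        fun x ↦ G (‖x‖⁻¹ • x) * k ‖x‖, restrict_compl_singleton]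
    _ = ∫ x : sphere (0 : E) 1 × Ioi (0 : ℝ), G x.1 * k x.2
          ∂μ.toSphere.prod (.volumeIoiPow (finrank ℝ E - 1)) := by
      simpa using μ.measurePreserving_homeomorphUnitSphereProd.integral_comp
        (Homeomorph.measurableEmbedding _)
        (fun x : sphere (0 : E) 1 × Ioi (0 : ℝ) => G x.1 * k x.2)
    _ = (∫ u : sphere (0 : E) 1, G u ∂μ.toSphere) *
        ∫ r : Ioi (0 : ℝ), k r ∂.volumeIoiPow (finrank ℝ E - 1) :=
      integral_prod_mul (fun u : sphere (0 : E) 1 => G u) (fun r : Ioi (0 : ℝ) => k r)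
    _ = _ := by
      simp only [Measure.volumeIoiPow, ENNReal.ofReal]
      rw [integral_withDensity_eq_integral_smul,
        integral_subtype_comap measurableSet_Ioi
          fun a ↦ Real.toNNReal (a ^ (finrank ℝ E - 1)) • k a,
        setIntegral_congr_fun measurableSet_Ioi fun x hx ↦ ?_]
      · rw [NNReal.smul_def, Real.coe_toNNReal _ (pow_nonneg hx.out.le _), smul_eq_mul]
      · exact (measurable_subtype_coe.pow_const _).real_toNNReal

/-- Radial densities concentrating on the unit sphere: integrals of a continuous function against
them tend to the integral over the sphere. -/
theorem tendsto_integral_mul_radial (μ : Measure E) [μ.IsAddHaarMeasure] {G : E → ℝ}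
    (hG : Continuous G) {κ : ℕ → ℝ → ℝ} {a : ℕ → ℝ} (hκ0 : ∀ n r, 0 < r → 0 ≤ κ n r)
    (hκs : ∀ n r, κ n r ≠ 0 → 0 < r → r ∈ Icc (a n) 1) (ha : Tendsto a atTop (𝓝 1))
    (hκ1 : ∀ n, ∫ r in Ioi (0 : ℝ), κ n r = 1) :
    Tendsto (fun n => ∫ x, G x * ((‖x‖ ^ (finrank ℝ E - 1))⁻¹ * κ n ‖x‖) ∂μ) atTop
      (𝓝 (∫ u : sphere (0 : E) 1, G u ∂μ.toSphere)) := by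
  set m := finrank ℝ E - 1 with hm
  -- A function of the direction alone integrates exactly to its spherical integral, for every `n`.
  -- The only error left is that of replacing `x` by `‖x‖⁻¹ • x`, which moves it by `1 - ‖x‖ ≤ 1 - a
  -- n` on the support; uniform continuity controls it.
  have hrad : ∀ n (F : E → ℝ), ∫ x, F (‖x‖⁻¹ • x) * ((‖x‖ ^ m)⁻¹ * κ n ‖x‖) ∂μ =
      ∫ u : sphere (0 : E) 1, F u ∂μ.toSphere := by
    intro n F
    rw [integral_direction_mul_norm μ F (fun r => (r ^ m)⁻¹ * κ n r)]
    have : ∫ r in Ioi (0 : ℝ), r ^ (finrank ℝ E - 1) * ((r ^ m)⁻¹ * κ n r) = 1 := by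
      rw [← hκ1 n]
      refine setIntegral_congr_fun measurableSet_Ioi fun r hr => ?_
      have : r ^ m ≠ 0 := pow_ne_zero _ (ne_of_gt hr)
      rw [← hm]
      field_simp
    rw [this, mul_one]
  have hκi : ∀ n, Integrable (fun x : E => (‖x‖ ^ m)⁻¹ * κ n ‖x‖) μ := by
    intro n
    rw [integrable_fun_norm_addHaar μ (f := fun r => (r ^ m)⁻¹ * κ n r)]
    have h1 : IntegrableOn (κ n) (Ioi 0) := by
      -- A non-integrable function has integral `0` by convention, which contradicts the value `1`.
      by_contra hcon
      have := hκ1 n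
      rw [integral_undef hcon] at this
      exact zero_ne_one this
    refine h1.congr_fun (fun r hr => ?_) measurableSet_Ioi
    have : r ^ m ≠ 0 := pow_ne_zero _ (ne_of_gt hr)
    simp only [smul_eq_mul, ← hm]
    field_simp
  have hw0 : ∀ n (x : E), 0 ≤ (‖x‖ ^ m)⁻¹ * κ n ‖x‖ ∨ x = 0 := by
    intro n x
    by_cases hx : x = 0
    · exact Or.inr hx
    · exact Or.inl (mul_nonneg (by positivity) (hκ0 n _ (norm_pos_iff.2 hx)))
  have hae : ∀ᵐ x ∂μ, x ≠ 0 := by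
    simp [ae_iff, measure_singleton]
  obtain ⟨C, hC⟩ := (isCompact_closedBall (0 : E) 1).exists_bound_of_continuousOn hG.continuousOn
  have hmeasd : Measurable fun x : E => ‖x‖⁻¹ • x := by fun_prop
  have hbd : ∀ n (F : E → ℝ), Measurable F → (∀ x ∈ closedBall (0 : E) 1, ‖F x‖ ≤ C) →
      Integrable (fun x => F x * ((‖x‖ ^ m)⁻¹ * κ n ‖x‖)) μ := by
    intro n F hF hFC
    refine ((hκi n).const_mul C).mono' (hF.aestronglyMeasurable.mul (hκi n).1) ?_
    filter_upwards [hae] with x hx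
    have h0 : 0 ≤ (‖x‖ ^ m)⁻¹ * κ n ‖x‖ := (hw0 n x).resolve_right hx
    rw [norm_mul, Real.norm_of_nonneg h0]
    by_cases hz : κ n ‖x‖ = 0
    · simp [hz]
    · exact mul_le_mul_of_nonneg_right
        (hFC x (by simpa using (hκs n _ hz (norm_pos_iff.2 hx)).2)) h0
  have hd1 : ∀ x : E, ‖x‖⁻¹ • x ∈ closedBall (0 : E) 1 := by
    intro x
    by_cases hx : x = 0
    · simp [hx]
    · simp [norm_smul, norm_ne_zero_iff.2 hx]
  have huc := (isCompact_closedBall (0 : E) 1).uniformContinuousOn_of_continuous hG.continuousOn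
  rw [Metric.uniformContinuousOn_iff] at huc
  rw [Metric.tendsto_atTop]
  intro ε hε
  set V := (μ.toSphere (E := E)).real univ with hV
  have hV0 : 0 ≤ V := measureReal_nonneg
  obtain ⟨δ, hδ, hδG⟩ := huc (ε / (V + 1)) (by positivity)
  obtain ⟨N, hN⟩ := (Metric.tendsto_atTop.1 ha) δ hδ
  refine ⟨N, fun n hn => ?_⟩
  rw [← hrad n G, dist_eq_norm, ← integral_sub (hbd n G hG.measurable hC)
    (hbd n (fun x => G (‖x‖⁻¹ • x)) (hG.measurable.comp hmeasd) fun x _ => hC _ (hd1 x))]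
  have hle : ‖∫ x, (G x * ((‖x‖ ^ m)⁻¹ * κ n ‖x‖) - G (‖x‖⁻¹ • x) * ((‖x‖ ^ m)⁻¹ * κ n ‖x‖)) ∂μ‖
      ≤ ∫ x, ε / (V + 1) * ((‖x‖ ^ m)⁻¹ * κ n ‖x‖) ∂μ := by
    refine norm_integral_le_of_norm_le ((hκi n).const_mul _) ?_
    filter_upwards [hae] with x hx
    have h0 : 0 ≤ (‖x‖ ^ m)⁻¹ * κ n ‖x‖ := (hw0 n x).resolve_right hx
    rw [← sub_mul, norm_mul, Real.norm_of_nonneg h0]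
    by_cases hz : κ n ‖x‖ = 0
    · simp [hz]
    · have hx0 := norm_pos_iff.2 hx
      have hxI := hκs n _ hz hx0
      refine mul_le_mul_of_nonneg_right ?_ h0
      rw [← dist_eq_norm]
      refine (hδG x (by simpa using hxI.2) _ (hd1 x) ?_).le
      have e : x - ‖x‖⁻¹ • x = (1 - ‖x‖⁻¹) • x := by module
      rw [dist_eq_norm, e, norm_smul, Real.norm_eq_abs, ← abs_of_pos hx0, ← abs_mul,
        abs_of_pos hx0, sub_mul, inv_mul_cancel₀ hx0.ne', one_mul, abs_sub_comm, abs_of_nonneg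
        (sub_nonneg.2 hxI.2)]
      have := hN n hn
      rw [Real.dist_eq, abs_sub_comm] at this
      have := le_abs_self (1 - a n)
      linarith [hxI.1]
  refine hle.trans_lt ?_
  have := hrad n (fun _ => ε / (V + 1))
  rw [this, integral_const, smul_eq_mul, ← hV, mul_div_assoc', div_lt_iff₀ (by positivity)]
  nlinarith

end Polar

/-! ### Radial cutoffs and the gradient inequality on the unit sphere -/

section SphereInequality

open Filter Topology Module Real

theorem Real.smoothTransition.differentiable : Differentiable ℝ smoothTransition :=
  (smoothTransition.contDiff (n := 1)).differentiable one_ne_zero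

theorem Real.smoothTransition.deriv_nonneg (t : ℝ) : 0 ≤ deriv smoothTransition t :=
  smoothTransition.monotone.deriv_nonneg

theorem Real.smoothTransition.mem_Icc_of_deriv_ne_zero {t : ℝ}
    (ht : deriv smoothTransition t ≠ 0) : t ∈ Icc (0 : ℝ) 1 := by
  constructor <;> by_contra! hlt <;> refine ht ?_
  · have : smoothTransition =ᶠ[𝓝 t] fun _ => 0 := by
      filter_upwards [gt_mem_nhds hlt] with s hs using smoothTransition.zero_of_nonpos hs.le
    rw [this.deriv_eq, deriv_const]
  · have : smoothTransition =ᶠ[𝓝 t] fun _ => 1 := by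
      filter_upwards [lt_mem_nhds hlt] with s hs using smoothTransition.one_of_one_le hs.le
    rw [this.deriv_eq, deriv_const]

/-- A smooth radial cutoff profile, equal to `1` for `r ^ 2 ≤ 1 - 2 * ε` and to `0` for
`1 - ε ≤ r ^ 2`. -/
noncomputable def cutoff (ε r : ℝ) : ℝ := smoothTransition ((1 - ε - r ^ 2) / ε)

/-- Minus the derivative of `cutoff`. -/
noncomputable def cutoffDensity (ε r : ℝ) : ℝ :=
  deriv smoothTransition ((1 - ε - r ^ 2) / ε) * (2 * r / ε)

theorem hasDerivAt_neg_cutoff (ε r : ℝ) :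
    HasDerivAt (fun r => -cutoff ε r) (cutoffDensity ε r) r := by
  have h1 : HasDerivAt (fun r : ℝ => (1 - ε - r ^ 2) / ε) (-(2 * r) / ε) r := by
    simpa using ((hasDerivAt_pow 2 r).const_sub (1 - ε)).div_const ε
  have := ((smoothTransition.differentiable _).hasDerivAt.comp r h1).neg
  convert! this using 1
  simp only [cutoffDensity]
  ring

theorem cutoffDensity_nonneg {ε r : ℝ} (hε : 0 < ε) (hr : 0 < r) : 0 ≤ cutoffDensity ε r :=
  mul_nonneg (smoothTransition.deriv_nonneg _) (by positivity)

theorem sq_mem_Icc_of_deriv_ne_zero {ε r : ℝ} (hε : 0 < ε)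
    (h : deriv smoothTransition ((1 - ε - r ^ 2) / ε) ≠ 0) :
    r ^ 2 ∈ Icc (1 - 2 * ε) (1 - ε) := by
  have := smoothTransition.mem_Icc_of_deriv_ne_zero h
  rw [mem_Icc, le_div_iff₀ hε, div_le_iff₀ hε] at this
  constructor <;> linarith [this.1, this.2]

theorem mem_Icc_of_deriv_ne_zero {ε r : ℝ} (hε : 0 < ε) (hε' : ε ≤ 1 / 4) (hr : 0 ≤ r)
    (h : deriv smoothTransition ((1 - ε - r ^ 2) / ε) ≠ 0) : r ∈ Icc (1 - 2 * ε) 1 := by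
  have := sq_mem_Icc_of_deriv_ne_zero hε h
  constructor <;> nlinarith [this.1, this.2]

/-- The primitive `-cutoff` rises from `-1` at `r = 0` to `0` for `r ≥ 1`. -/
theorem integral_cutoffDensity {ε : ℝ} (hε : 0 < ε) (hε' : ε ≤ 1 / 4) :
    ∫ r in Ioi (0 : ℝ), cutoffDensity ε r = 1 := by
  rw [integral_Ioi_of_hasDerivAt_of_nonneg' (g := fun r => -cutoff ε r) (l := 0)
    (fun r _ => hasDerivAt_neg_cutoff ε r) fun r hr => cutoffDensity_nonneg hε hr]
  · have : cutoff ε 0 = 1 := smoothTransition.one_of_one_le (by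
      rw [le_div_iff₀ hε]; linarith)
    rw [this]; norm_num
  · refine tendsto_const_nhds.congr' ?_
    filter_upwards [eventually_ge_atTop 1] with r hr
    have : cutoff ε r = 0 := smoothTransition.zero_of_nonpos
      (div_nonpos_of_nonpos_of_nonneg (by nlinarith) hε.le)
    rw [this, neg_zero]

variable {E : Type*} [NormedAddCommGroup E] [InnerProductSpace ℝ E]

theorem hasFDerivAt_cutoff_norm (ε : ℝ) (x : E) :
    HasFDerivAt (fun x : E => cutoff ε ‖x‖)
      (deriv smoothTransition ((1 - ε - ‖x‖ ^ 2) / ε) • ((-ε⁻¹) • (2 • innerSL ℝ x))) x := by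
  have h1 : HasFDerivAt (fun x : E => (1 - ε - ‖x‖ ^ 2) / ε) ((-ε⁻¹) • (2 • innerSL ℝ x)) x := by
    have := ((hasStrictFDerivAt_norm_sq x).hasFDerivAt.const_sub (1 - ε)).mul_const ε⁻¹
    convert! this using 1
    module
  exact (smoothTransition.differentiable _).hasDerivAt.comp_hasFDerivAt x h1

theorem contDiff_cutoff_norm (ε : ℝ) : ContDiff ℝ 1 (fun x : E => cutoff ε ‖x‖) := by
  unfold cutoff
  exact smoothTransition.contDiff.comp
    ((contDiff_const.sub (contDiff_norm_sq ℝ)).div_const _)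

variable [FiniteDimensional ℝ E] [MeasurableSpace E] [BorelSpace E]

theorem tendsto_integral_cutoff (μ : Measure E) [μ.IsAddHaarMeasure] {ε : ℕ → ℝ}
    (hε : ∀ n, 0 < ε n) (hε0 : Tendsto ε atTop (𝓝 0)) :
    Tendsto (fun n => ∫ x, cutoff (ε n) ‖x‖ ∂μ) atTop (𝓝 (μ.real (ball 0 1))) := by
  rw [← integral_indicator_one measurableSet_ball]
  refine tendsto_integral_of_dominated_convergence ((closedBall (0 : E) 1).indicator 1)
    (fun n => ((contDiff_cutoff_norm (ε n)).continuous).aestronglyMeasurable) ?_ ?_ ?_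
  · exact (integrable_indicator_iff measurableSet_closedBall).2
      (integrableOn_const (measure_closedBall_lt_top.ne))
  · refine fun n => Eventually.of_forall fun x => ?_
    by_cases hx : x ∈ closedBall (0 : E) 1
    · rw [indicator_of_mem hx]
      refine (Real.norm_of_nonneg (smoothTransition.nonneg _)).trans_le ?_
      exact smoothTransition.le_one _
    · rw [indicator_of_notMem hx]
      have hx1 : 1 < ‖x‖ := by simpa using hx
      have : cutoff (ε n) ‖x‖ = 0 := smoothTransition.zero_of_nonpos
        (div_nonpos_of_nonpos_of_nonneg (by nlinarith [hε n]) (hε n).le)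
      rw [this, norm_zero]
  · refine Eventually.of_forall fun x => tendsto_const_nhds.congr' ?_
    by_cases hx : x ∈ ball (0 : E) 1
    · have hx1 : ‖x‖ < 1 := by simpa using hx
      have hx2 : 0 < (1 - ‖x‖ ^ 2) / 2 := by nlinarith [norm_nonneg x]
      filter_upwards [hε0.eventually (gt_mem_nhds hx2)] with n hn
      rw [indicator_of_mem hx, Pi.one_apply]
      refine (smoothTransition.one_of_one_le ?_).symm
      rw [le_div_iff₀ (hε n)]
      linarith
    · have hx1 : 1 ≤ ‖x‖ := by simpa using hx
      refine Eventually.of_forall fun n => ?_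
      rw [indicator_of_notMem hx]
      exact (smoothTransition.zero_of_nonpos
        (div_nonpos_of_nonpos_of_nonneg (by nlinarith [hε n]) (hε n).le)).symm

/-- One-point gradient estimate: for a convex function `h`, the integral of `h(u) ⟪u, w⟫` over the
unit sphere is at most the volume of the unit ball times the difference of a bound of `h` on the
ball around `w` and the value of `h` at the centre. -/
theorem integral_sphere_mul_inner_le [Nontrivial E] (μ : Measure E) [μ.IsAddHaarMeasure] {h : E → ℝ} {Q : Set E}
    {w : E} {M : ℝ} (hh : ConvexOn ℝ Q h) (hB : closedBall 0 1 ⊆ Q) (hBw : closedBall w 1 ⊆ Q)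
    (hM : ∀ v ∈ closedBall w 1, h v ≤ M) (hc : ContinuousOn h (closedBall 0 1)) :
    ∫ u : sphere (0 : E) 1, h u * inner ℝ (u : E) w ∂μ.toSphere ≤
      (M - h 0) * μ.real (ball 0 1) := by
  -- Tietze extension: `h` is continuous only on the closed ball, while the radial limit needs a
  -- globally continuous function.
  obtain ⟨g, hg⟩ := ContinuousMap.exists_restrict_eq (isClosed_closedBall (x := (0 : E)) (ε := 1))
    ⟨_, hc.domRestrict⟩
  have hgh : ∀ x ∈ closedBall (0 : E) 1, g x = h x := fun x hx => by
    simpa using DFunLike.congr_fun hg ⟨x, hx⟩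
  set ε : ℕ → ℝ := fun n => 1 / 4 * (1 / ((n : ℝ) + 1)) with hεdef
  have hε : ∀ n, 0 < ε n := fun n => by positivity
  have hε4 : ∀ n, ε n ≤ 1 / 4 := fun n => by
    have : 1 / ((n : ℝ) + 1) ≤ 1 := by
      rw [div_le_one (by positivity)]; linarith [(Nat.cast_nonneg n : (0 : ℝ) ≤ n)]
    simp only [hεdef]; linarith
  have hε0 : Tendsto ε atTop (𝓝 0) := by
    simpa [hεdef] using
      (tendsto_one_div_add_atTop_nhds_zero_nat (𝕜 := ℝ)).const_mul (1 / 4 : ℝ)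
  -- The derivative of the cutoff in direction `w` is `-cutoffDensity` times `⟪x, w⟫ / ‖x‖`. The
  -- power of `‖x‖` cancels the polar weight, and the maximum with `1 / 2` removes the singularity
  -- at the origin without changing anything on the support, where `‖x‖ ≥ 1 - 2 ε ≥ 1 / 2`. On the
  -- sphere the last factor is `1`.
  set G : E → ℝ := fun x =>
    g x * inner ℝ x w * (‖x‖ ^ (finrank ℝ E - 1) * (max ‖x‖ (1 / 2))⁻¹) with hGdef
  have hGc : Continuous G := by
    have : Continuous fun x : E => (max ‖x‖ (1 / 2))⁻¹ :=
      (continuous_norm.max continuous_const).inv₀ fun x =>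
        (lt_of_lt_of_le (by norm_num : (0 : ℝ) < 1 / 2) (le_max_right _ _)).ne'
    fun_prop
  have hlim := tendsto_integral_mul_radial μ hGc (κ := fun n => cutoffDensity (ε n))
    (a := fun n => 1 - 2 * ε n) (fun n r hr => cutoffDensity_nonneg (hε n) hr)
    (fun n r hκ hr => mem_Icc_of_deriv_ne_zero (hε n) (hε4 n) hr.le (left_ne_zero_of_mul hκ))
    (by simpa using (hε0.const_mul 2).const_sub 1)
    (fun n => integral_cutoffDensity (hε n) (hε4 n))
  have hGS : ∫ u : sphere (0 : E) 1, G u ∂μ.toSphere =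
      ∫ u : sphere (0 : E) 1, h u * inner ℝ (u : E) w ∂μ.toSphere := by
    refine integral_congr_ae (Eventually.of_forall fun u => ?_)
    have hu : ‖(u : E)‖ = 1 := by simp
    simp only [hGdef, hu]
    rw [hgh _ (by simp)]
    norm_num
  rw [hGS] at hlim
  refine le_of_tendsto_of_tendsto' hlim
    ((tendsto_integral_cutoff μ hε hε0).const_mul (M - h 0)) fun n => ?_
  have hint : IntegrableOn h (closedBall 0 1) μ :=
    hc.integrableOn_compact (isCompact_closedBall _ _)
  refine le_of_eq_of_le ?_ (neg_integral_mul_fderiv_le μ hh hB hBw hM hint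
    (contDiff_cutoff_norm (ε n)) (fun x => by simp) (fun x => smoothTransition.nonneg _)
    (ρ := √(1 - ε n)) ?_ ?_)
  · rw [← integral_neg, ← integral_indicator measurableSet_closedBall]
    have hae : ∀ᵐ x ∂μ, x ≠ 0 := by simp [ae_iff, measure_singleton]
    refine integral_congr_ae ?_
    filter_upwards [hae] with x hx
    have hx0 := norm_pos_iff.2 hx
    have e : (closedBall (0 : E) 1).indicator
        (fun x => -(h x * fderiv ℝ (fun x : E => cutoff (ε n) ‖x‖) x w)) x =
        (closedBall (0 : E) 1).indicator
        (fun x => h x * (deriv smoothTransition ((1 - ε n - ‖x‖ ^ 2) / ε n) *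
          (2 / ε n * inner ℝ x w))) x := by
      congr 1
      ext x
      have e' : (deriv smoothTransition ((1 - ε n - ‖x‖ ^ 2) / ε n) •
          ((-(ε n)⁻¹) • (2 • innerSL ℝ x))) w =
          -(deriv smoothTransition ((1 - ε n - ‖x‖ ^ 2) / ε n) * (2 / ε n * inner ℝ x w)) := by
        simp only [_root_.smul_apply, innerSL_apply_apply, smul_eq_mul, nsmul_eq_mul]
        push_cast
        ring
      rw [(hasFDerivAt_cutoff_norm (ε n) x).fderiv, e']
      ring
    rw [e]
    by_cases hz : deriv smoothTransition ((1 - ε n - ‖x‖ ^ 2) / ε n) = 0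
    · simp [cutoffDensity, hz, indicator]
    · have hI := mem_Icc_of_deriv_ne_zero (hε n) (hε4 n) hx0.le hz
      have hxB : x ∈ closedBall (0 : E) 1 := by simpa using hI.2
      have hmax : max ‖x‖ (1 / 2) = ‖x‖ := max_eq_left (by linarith [hI.1, hε4 n])
      rw [indicator_of_mem hxB]
      simp only [hGdef, hmax, hgh x hxB, cutoffDensity]
      have := (hε n).ne'
      field_simp
  · rw [Real.sqrt_lt' one_pos]; linarith [hε n]
  · intro x hx
    have := (Real.sqrt_le_left (norm_nonneg x)).1 hx
    exact smoothTransition.zero_of_nonpos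
      (div_nonpos_of_nonpos_of_nonneg (by linarith) (hε n).le)

end SphereInequality

/-! ### The gradient estimate for uniform directions -/

section UniformSphere

open Module

theorem isProbabilityMeasure_uniformSphere {d : ℕ} (hd : 0 < d) :
    IsProbabilityMeasure (uniformSphere d) := by
  have : Nonempty (Fin d) := ⟨⟨0, hd⟩⟩
  refine ⟨?_⟩
  rw [uniformSphere, Measure.smul_apply, smul_eq_mul]
  exact ENNReal.inv_mul_cancel (Measure.measure_univ_ne_zero.2
    (Measure.toSphere_ne_zero (volume : Measure (Euc d)))) (measure_ne_top _ _)

/-- The unit sphere has `d` times the measure of the unit ball; this is the source of the factor `d`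
in the gradient estimate. -/
theorem natCast_mul_integral_uniformSphere {d : ℕ} (hd : 0 < d) (F : UnitSphere d → ℝ) :
    (d : ℝ) * ∫ u, F u ∂uniformSphere d =
      ((volume : Measure (Euc d)).real (ball 0 1))⁻¹ *
        ∫ u, F u ∂(volume : Measure (Euc d)).toSphere := by
  have hd' : (d : ℝ) ≠ 0 := by positivity
  rw [uniformSphere, integral_smul_measure, ENNReal.toReal_inv, ← measureReal_def,
    Measure.toSphere_real_apply_univ, smul_eq_mul, finrank_euclideanSpace, Fintype.card_fin,
    mul_inv, ← mul_assoc, ← mul_assoc, mul_inv_cancel₀ hd', one_mul]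

/-- One-point gradient estimate at `y`, in the direction of `z`. -/
theorem integral_uniformSphere_mul_inner_le {d : ℕ} (hd : 0 < d) {f : Euc d → ℝ} {K : Set (Euc d)}
    {y z : Euc d} {δ M : ℝ} (hδ : 0 < δ) (hf : ConvexOn ℝ K f) (hy : closedBall y δ ⊆ K)
    (hz : closedBall z δ ⊆ K) (hM : ∀ v ∈ closedBall z δ, f v ≤ M)
    (hc : ContinuousOn f (closedBall y δ)) :
    d / δ * ∫ u : UnitSphere d, f (y + δ • (u : Euc d)) * inner ℝ (u : Euc d) (z - y)
      ∂uniformSphere d ≤ M - f y := by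
  have : Nonempty (Fin d) := ⟨⟨0, hd⟩⟩
  -- This map carries the unit balls around `0` and `δ⁻¹ • (z - y)` into the `δ`-balls around `y`
  -- and `z`, so the inequality is used with `w = δ⁻¹ • (z - y)`.
  set A : Euc d →ᵃ[ℝ] Euc d := δ • AffineMap.id ℝ (Euc d) + AffineMap.const ℝ (Euc d) y with hA
  have hAv : ∀ v, A v = y + δ • v := fun v => by simp [hA, add_comm]
  have hin : ∀ v ∈ closedBall (0 : Euc d) 1, A v ∈ closedBall y δ := fun v hv => by
    rw [mem_closedBall_zero_iff] at hv
    rw [hAv, mem_closedBall_iff_norm, add_sub_cancel_left, norm_smul, Real.norm_of_nonneg hδ.le]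
    nlinarith
  have hin' : ∀ v ∈ closedBall (δ⁻¹ • (z - y)) 1, A v ∈ closedBall z δ := fun v hv => by
    rw [mem_closedBall_iff_norm] at hv
    have : y + δ • v - z = δ • (v - δ⁻¹ • (z - y)) := by
      rw [smul_sub, smul_inv_smul₀ hδ.ne']; abel
    rw [hAv, mem_closedBall_iff_norm, this, norm_smul, Real.norm_of_nonneg hδ.le]
    nlinarith
  have key := integral_sphere_mul_inner_le (volume : Measure (Euc d)) (h := f ∘ A) (M := M)
    (hf.comp_affineMap A) (fun v hv => hy (hin v hv)) (fun v hv => hz (hin' v hv))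
    (fun v hv => hM _ (hin' v hv)) (hc.comp (by rw [funext hAv]; fun_prop) hin)
  have hV : 0 < (volume : Measure (Euc d)).real (ball 0 1) :=
    ENNReal.toReal_pos (measure_ball_pos _ _ one_pos).ne' measure_ball_lt_top.ne
  rw [← div_le_iff₀ hV, div_eq_inv_mul, ← natCast_mul_integral_uniformSphere hd] at key
  simp only [Function.comp_apply, hAv, smul_zero, add_zero, inner_smul_right] at key
  refine le_of_eq_of_le ?_ key
  rw [div_mul_eq_mul_div, mul_div_assoc, ← integral_div]
  congr 2
  ext u
  field_simp

end UniformSphere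

/-! ### Projection onto closed convex sets -/

section NearestPoint

variable {d : ℕ} {K : Set (Euc d)}

theorem inner_sub_nearestPoint_le_zero (hK : IsClosed K) (hne : K.Nonempty) (hc : Convex ℝ K)
    (x : Euc d) {z : Euc d} (hz : z ∈ K) :
    inner ℝ (x - nearestPoint K x) (z - nearestPoint K x) ≤ 0 := by
  obtain ⟨hp, hmin⟩ := nearestPoint_spec hK hne x
  refine (norm_eq_iInf_iff_real_inner_le_zero hc hp).1 (le_antisymm ?_ ?_) z hz
  · have : Nonempty K := ⟨⟨_, hp⟩⟩
    exact le_ciInf fun w => hmin w w.2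
  · exact ciInf_le ⟨0, by rintro _ ⟨w, rfl⟩; exact norm_nonneg _⟩ (⟨_, hp⟩ : K)

/-- Adding the variational inequalities at the two projections gives `‖p - q‖ ^ 2 ≤ ⟪x - z, p - q⟫`;
Cauchy–Schwarz finishes. -/
theorem norm_nearestPoint_sub_nearestPoint_le (hK : IsClosed K) (hne : K.Nonempty)
    (hc : Convex ℝ K) (x z : Euc d) : ‖nearestPoint K x - nearestPoint K z‖ ≤ ‖x - z‖ := by
  set p := nearestPoint K x
  set q := nearestPoint K z
  have h1 := inner_sub_nearestPoint_le_zero hK hne hc x (nearestPoint_spec hK hne z).1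
  have h2 := inner_sub_nearestPoint_le_zero hK hne hc z (nearestPoint_spec hK hne x).1
  have e : inner ℝ (x - z) (p - q) =
      inner ℝ (p - q) (p - q) - inner ℝ (x - p) (q - p) - inner ℝ (z - q) (p - q) := by
    have : x - z = (p - q) + (x - p) - (z - q) := by abel
    have e2 : q - p = -(p - q) := by abel
    rw [e2, this, inner_sub_left, inner_add_left, inner_neg_right]
    ring
  have h3 := real_inner_le_norm (x - z) (p - q)
  rw [e, real_inner_self_eq_norm_sq] at h3
  by_contra! hlt
  nlinarith [norm_nonneg (x - z)]

theorem continuous_nearestPoint (hK : IsClosed K) (hne : K.Nonempty) (hc : Convex ℝ K) :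
    Continuous (nearestPoint K) :=
  (LipschitzWith.of_dist_le_mul (K := 1) fun x z => by
    simpa [dist_eq_norm] using norm_nearestPoint_sub_nearestPoint_le hK hne hc x z).continuous

theorem nearestPoint_eq_self {x : Euc d} (hx : x ∈ K) (hK : IsClosed K) :
    nearestPoint K x = x := by
  have h := (nearestPoint_spec hK ⟨x, hx⟩ x).2 x hx
  rw [sub_self, norm_zero] at h
  exact (sub_eq_zero.1 (norm_le_zero_iff.1 h)).symm

theorem norm_nearestPoint_sub_le (hK : IsClosed K) (hc : Convex ℝ K) (x : Euc d) {z : Euc d}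
    (hz : z ∈ K) : ‖nearestPoint K x - z‖ ≤ ‖x - z‖ := by
  simpa [nearestPoint_eq_self hz hK] using
    norm_nearestPoint_sub_nearestPoint_le hK ⟨z, hz⟩ hc x z

end NearestPoint

/-! ### Freezing one of two independent variables -/

section Independence

variable {Ω X U : Type*} [MeasurableSpace Ω] [MeasurableSpace X] [MeasurableSpace U]

/-- Conditioning on one of two independent variables: an upper bound for the integrals over the
second variable with the first one frozen bounds the expectation. -/
theorem integral_le_of_indepFun {μ : Measure Ω} [IsProbabilityMeasure μ] {σ : Measure U}
    [IsProbabilityMeasure σ] {Y : Ω → X} {V : Ω → U} (hY : Measurable Y) (hV : Measurable V)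
    (hlaw : μ.map V = σ) (hind : IndepFun Y V μ) {F : X × U → ℝ} (hF : Measurable F)
    (hint : Integrable (fun ω => F (Y ω, V ω)) μ) {c : ℝ}
    (hc : ∀ ω, ∫ v, F (Y ω, v) ∂σ ≤ c) : ∫ ω, F (Y ω, V ω) ∂μ ≤ c := by
  have hmap : μ.map (fun ω => (Y ω, V ω)) = (μ.map Y).prod σ := by
    rw [← hlaw]
    exact (indepFun_iff_map_prod_eq_prod_map_map hY.aemeasurable hV.aemeasurable).1 hind
  have hYV : Measurable fun ω => (Y ω, V ω) := hY.prodMk hV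
  have hint' : Integrable F ((μ.map Y).prod σ) := by
    rw [← hmap]
    exact (integrable_map_measure hF.aestronglyMeasurable hYV.aemeasurable).2 hint
  have : IsProbabilityMeasure (μ.map Y) := Measure.isProbabilityMeasure_map hY.aemeasurable
  have h1 : ∫ ω, F (Y ω, V ω) ∂μ = ∫ ω, ∫ v, F (Y ω, v) ∂σ ∂μ := by
    rw [← integral_map (f := F) hYV.aemeasurable hF.aestronglyMeasurable, hmap,
      integral_prod _ hint', integral_map hY.aemeasurable hint'.integral_prod_left.1]
  rw [h1]
  have h2 : Integrable (fun ω => ∫ v, F (Y ω, v) ∂σ) μ :=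
    hint'.integral_prod_left.comp_measurable hY
  calc ∫ ω, ∫ v, F (Y ω, v) ∂σ ∂μ ≤ ∫ _, c ∂μ := integral_mono h2 (integrable_const c) hc
    _ = c := by simp

end Independence

/-! ### Gradient descent along a fixed sequence of directions -/

/-- Data on which bandit gradient descent is run: a closed convex set `K` between the unit ball and
the ball of radius `D`, convex costs bounded by `C`, and a measurable set `A` which contains all
points that may be played and on which the costs are continuous. -/
structure IsBGDData {d : ℕ} (n : ℕ) (K A : Set (Euc d)) (f : ℕ → Euc d → ℝ) (C D δ α : ℝ) :
    Prop where
  closed : IsClosed K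
  convex : Convex ℝ K
  ball_subset : closedBall 0 1 ⊆ K
  subset_ball : K ⊆ closedBall 0 D
  cost_convex : ∀ t < n, ConvexOn ℝ K (f t)
  cost_bounded : ∀ t < n, ∀ x ∈ K, |f t x| ≤ C
  measurableSet : MeasurableSet A
  cost_continuous : ∀ t < n, ContinuousOn (f t) A
  delta_pos : 0 < δ
  delta_le : δ ≤ α
  alpha_le : α ≤ 1
  played_subset : ∀ y ∈ (1 - α) • K, closedBall y δ ⊆ A

/-- A point within `α` of `(1 - α) • k` is the convex combination of `k` and a point of the unit
ball with weights `1 - α` and `α`. -/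
theorem closedBall_subset_of_mem_smul {d : ℕ} {K : Set (Euc d)} (hc : Convex ℝ K)
    (hK : closedBall 0 1 ⊆ K) {α : ℝ} (hα : 0 < α) (hα1 : α ≤ 1) {y : Euc d}
    (hy : y ∈ (1 - α) • K) : closedBall y α ⊆ K := by
  obtain ⟨k, hk, rfl⟩ := hy
  intro v hv
  have hb : α⁻¹ • (v - (1 - α) • k) ∈ closedBall (0 : Euc d) 1 := by
    rw [mem_closedBall_iff_norm] at hv
    rw [mem_closedBall_zero_iff, norm_smul, norm_inv, Real.norm_of_nonneg hα.le,
      inv_mul_le_iff₀ hα, mul_one]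
    exact hv
  have := hc hk (hK hb) (sub_nonneg.2 hα1) hα.le (by ring)
  rwa [smul_inv_smul₀ hα.ne', add_sub_cancel] at this

namespace IsBGDData

variable {d n : ℕ} {K A : Set (Euc d)} {f : ℕ → Euc d → ℝ} {C D ν δ α : ℝ}

section Deterministic

theorem alpha_pos (H : IsBGDData n K A f C D δ α) : 0 < α := H.delta_pos.trans_le H.delta_le

theorem zero_mem (H : IsBGDData n K A f C D δ α) : (0 : Euc d) ∈ K :=
  H.ball_subset (by simp)

theorem nonempty_smul (H : IsBGDData n K A f C D δ α) : ((1 - α) • K).Nonempty :=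
  ⟨_, smul_mem_smul_set H.zero_mem⟩

theorem isClosed_smul (H : IsBGDData n K A f C D δ α) : IsClosed ((1 - α) • K) :=
  ((isCompact_of_isClosed_isBounded H.closed
    (isBounded_closedBall.subset H.subset_ball)).smul (1 - α)).isClosed

theorem convex_smul (H : IsBGDData n K A f C D δ α) : Convex ℝ ((1 - α) • K) :=
  H.convex.smul _

theorem closedBall_delta_subset (H : IsBGDData n K A f C D δ α) {y : Euc d}
    (hy : y ∈ (1 - α) • K) : closedBall y δ ⊆ K :=
  (closedBall_subset_closedBall H.delta_le).trans
    (closedBall_subset_of_mem_smul H.convex H.ball_subset H.alpha_pos H.alpha_le hy)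

theorem centre_mem_smul (H : IsBGDData n K A f C D δ α) (ν : ℝ) (u : ℕ → UnitSphere d) :
    ∀ t, bgdCentre K f ν δ α u t ∈ (1 - α) • K
  | 0 => by simpa [bgdCentre] using smul_mem_smul_set (a := 1 - α) H.zero_mem
  | _ + 1 => (nearestPoint_spec H.isClosed_smul H.nonempty_smul _).1

theorem add_smul_mem_closedBall (H : IsBGDData n K A f C D δ α) (y : Euc d) (u : UnitSphere d) :
    y + δ • (u : Euc d) ∈ closedBall y δ := by
  simp [norm_smul, abs_of_pos H.delta_pos]

theorem point_mem (H : IsBGDData n K A f C D δ α) (ν : ℝ) (u : ℕ → UnitSphere d) (t : ℕ) :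
    bgdPoint K f ν δ α u t ∈ K :=
  H.closedBall_delta_subset (H.centre_mem_smul ν u t) (H.add_smul_mem_closedBall _ _)

theorem point_mem_played (H : IsBGDData n K A f C D δ α) (ν : ℝ) (u : ℕ → UnitSphere d) (t : ℕ) :
    bgdPoint K f ν δ α u t ∈ A :=
  H.played_subset _ (H.centre_mem_smul ν u t) (H.add_smul_mem_closedBall _ _)

theorem norm_le (H : IsBGDData n K A f C D δ α) {z : Euc d} (hz : z ∈ K) : ‖z‖ ≤ D := by
  simpa using H.subset_ball hz

theorem smul_subset (H : IsBGDData n K A f C D δ α) : (1 - α) • K ⊆ K := fun _ hy =>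
  H.closedBall_delta_subset hy (mem_closedBall_self H.delta_pos.le)

/-- The costs on the ball around a shrunk comparator are controlled by the cost of the
comparator. -/
theorem cost_le_of_mem_closedBall (H : IsBGDData n K A f C D δ α) {t : ℕ} (ht : t < n)
    {z v : Euc d} (hz : z ∈ K) (hv : v ∈ closedBall ((1 - α) • z) δ) :
    f t v ≤ f t z + 2 * α * C := by
  have hα := H.alpha_pos
  have hb : α⁻¹ • (v - (1 - α) • z) ∈ K := by
    refine H.ball_subset ?_
    rw [mem_closedBall_iff_norm] at hv
    rw [mem_closedBall_zero_iff, norm_smul, norm_inv, Real.norm_of_nonneg hα.le,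
      inv_mul_le_iff₀ hα, mul_one]
    exact hv.trans H.delta_le
  have := (H.cost_convex t ht).2 hz hb (sub_nonneg.2 H.alpha_le) hα.le (by ring)
  rw [smul_inv_smul₀ hα.ne', add_sub_cancel, smul_eq_mul, smul_eq_mul] at this
  have h1 := (abs_le.1 (H.cost_bounded t ht _ hb)).2
  have h2 := (abs_le.1 (H.cost_bounded t ht _ hz)).1
  nlinarith

/-- The regret inequality of projected gradient descent along a fixed sequence of directions. -/
theorem sum_mul_inner_le (H : IsBGDData n K A f C D δ α) (ν : ℝ) (u : ℕ → UnitSphere d)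
    {z : Euc d} (hz : z ∈ (1 - α) • K) :
    2 * ν * ∑ t ∈ Finset.range n, f t (bgdPoint K f ν δ α u t) *
      inner ℝ (u t : Euc d) (bgdCentre K f ν δ α u t - z) ≤ D ^ 2 + n * (ν ^ 2 * C ^ 2) := by
  -- The potential is the squared distance to `z`. Projecting does not increase it, and each step
  -- adds at most `ν ^ 2 * C ^ 2` beyond the inner product term because directions are unit vectors.
  have key : ∀ m ≤ n, ‖bgdCentre K f ν δ α u m - z‖ ^ 2 +
      2 * ν * ∑ t ∈ Finset.range m, f t (bgdPoint K f ν δ α u t) *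
        inner ℝ (u t : Euc d) (bgdCentre K f ν δ α u t - z) ≤ D ^ 2 + m * (ν ^ 2 * C ^ 2) := by
    intro m
    induction m with
    | zero =>
      intro _
      have := H.norm_le (H.smul_subset hz)
      simp only [bgdCentre, zero_sub, norm_neg, Finset.range_zero, Finset.sum_empty, mul_zero,
        add_zero, Nat.cast_zero, zero_mul]
      exact pow_le_pow_left₀ (norm_nonneg _) this 2
    | succ m ih =>
      intro hm
      have ih := ih (by omega)
      set y := bgdCentre K f ν δ α u m with hy
      set a := f m (bgdPoint K f ν δ α u m) with ha
      have hy' : bgdCentre K f ν δ α u (m + 1) =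
        nearestPoint ((1 - α) • K) (y - (ν * a) • (u m : Euc d)) := rfl
      have h1 := norm_nearestPoint_sub_le H.isClosed_smul H.convex_smul
        (y - (ν * a) • (u m : Euc d)) hz
      rw [← hy'] at h1
      have h2 := pow_le_pow_left₀ (norm_nonneg _) h1 2
      have e : y - (ν * a) • (u m : Euc d) - z = (y - z) - (ν * a) • (u m : Euc d) := by abel
      rw [e, norm_sub_sq_real (y - z), norm_smul, mul_pow, inner_smul_right, real_inner_comm] at h2
      have hu : ‖(u m : Euc d)‖ = 1 := by simp
      have h3 : a ^ 2 ≤ C ^ 2 := by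
        rw [← sq_abs]
        exact pow_le_pow_left₀ (abs_nonneg _) (H.cost_bounded m (by omega) _ (H.point_mem _ _ _)) 2
      rw [hu, Real.norm_eq_abs, sq_abs] at h2
      rw [Finset.sum_range_succ, ← hy, ← ha]
      push_cast
      have h4 := mul_le_mul_of_nonneg_left h3 (sq_nonneg ν)
      linarith
  have := key n le_rfl
  nlinarith [sq_nonneg ‖bgdCentre K f ν δ α u n - z‖]

end Deterministic

/-! ### Measurability, independence and expected cost -/

section Random

variable {Ω : Type*} {u : ℕ → Ω → UnitSphere d}

/-- A cost is arbitrary outside `K`, and a convex one may be irregular on the boundary. Cutting it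
off outside `A` makes it Borel and changes no played value. -/
theorem measurable_indicator (H : IsBGDData n K A f C D δ α) {t : ℕ} (ht : t < n) :
    Measurable (A.indicator (f t)) := by
  classical
  rw [← piecewise_eq_indicator]
  exact (H.cost_continuous t ht).measurable_piecewise continuousOn_const H.measurableSet

/-- The σ-algebra generated by the directions before `t` is what makes the centre independent of `u
t`. -/
theorem measurable_centre (H : IsBGDData n K A f C D δ α) (ν : ℝ) :
    ∀ t ≤ n, Measurable[⨆ s ∈ Iio t, MeasurableSpace.comap (u s) inferInstance]
      fun ω => bgdCentre K f ν δ α (fun s => u s ω) t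
  | 0, _ => measurable_const
  | t + 1, ht => by
    have ih := measurable_centre H ν t (by omega)
    have hle : (⨆ s ∈ Iio t, MeasurableSpace.comap (u s) inferInstance) ≤
        ⨆ s ∈ Iio (t + 1), MeasurableSpace.comap (u s) inferInstance :=
      biSup_mono fun s (hs : s < t) => (hs.trans t.lt_succ_self : s < t + 1)
    have hu : Measurable[⨆ s ∈ Iio (t + 1), MeasurableSpace.comap (u s) inferInstance] (u t) :=
      (comap_measurable (u t)).mono
        (le_biSup (fun s => MeasurableSpace.comap (u s) inferInstance)
          (mem_Iio.2 t.lt_succ_self)) le_rfl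
    have hF : Measurable fun p : Euc d × UnitSphere d => nearestPoint ((1 - α) • K)
        (p.1 - (ν * A.indicator (f t) (p.1 + δ • (p.2 : Euc d))) • (p.2 : Euc d)) := by
      refine (continuous_nearestPoint H.isClosed_smul H.nonempty_smul
        H.convex_smul).measurable.comp ?_
      have h1 : Measurable fun p : Euc d × UnitSphere d =>
          A.indicator (f t) (p.1 + δ • (p.2 : Euc d)) :=
        (H.measurable_indicator (by omega)).comp (by fun_prop)
      fun_prop
    have h := hF.comp ((ih.mono hle le_rfl).prodMk hu)
    convert h using 1
    ext1 ω
    have hmem := H.point_mem_played ν (fun s => u s ω) t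
    simp only [bgdPoint] at hmem
    simp only [Function.comp_apply, indicator_of_mem hmem, bgdCentre]

variable [MeasurableSpace Ω] {μ : Measure Ω}

theorem measurable_centre' (H : IsBGDData n K A f C D δ α) (hu : ∀ t, Measurable (u t)) (ν : ℝ)
    {t : ℕ} (ht : t ≤ n) : Measurable fun ω => bgdCentre K f ν δ α (fun s => u s ω) t :=
  (H.measurable_centre ν t ht).mono (iSup₂_le fun s _ => (hu s).comap_le) le_rfl

theorem indepFun_centre (H : IsBGDData n K A f C D δ α) (hu : IsUniformDirections μ u) (ν : ℝ)
    {t : ℕ} (ht : t ≤ n) :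
    IndepFun (fun ω => bgdCentre K f ν δ α (fun s => u s ω) t) (u t) μ := by
  have h := indep_iSup_of_disjoint (m := fun s => MeasurableSpace.comap (u s) inferInstance)
    (fun s => (hu.measurable s).comap_le) hu.indep (S := Iio t) (T := {t}) (by simp)
  rw [IndepFun_iff_Indep]
  refine indep_of_indep_of_le_left (indep_of_indep_of_le_right h ?_)
    (H.measurable_centre ν t ht).comap_le
  exact le_biSup (fun s => MeasurableSpace.comap (u s) inferInstance) (mem_singleton t)

theorem measurable_cost_point (H : IsBGDData n K A f C D δ α) (hu : ∀ t, Measurable (u t)) (ν : ℝ)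
    {t : ℕ} (ht : t < n) :
    Measurable fun ω => f t (bgdPoint K f ν δ α (fun s => u s ω) t) := by
  have h := (H.measurable_indicator ht).comp
    ((H.measurable_centre' hu ν ht.le).add ((hu t).subtype_val.const_smul δ))
  convert h using 1
  ext1 ω
  exact (indicator_of_mem (H.point_mem_played ν (fun s => u s ω) t) _).symm

theorem integrable_cost_point [IsProbabilityMeasure μ] (H : IsBGDData n K A f C D δ α)
    (hu : ∀ t, Measurable (u t)) (ν : ℝ) {t : ℕ} (ht : t < n) :
    Integrable (fun ω => f t (bgdPoint K f ν δ α (fun s => u s ω) t)) μ :=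
  Integrable.of_bound (H.measurable_cost_point hu ν ht).aestronglyMeasurable C
    (Filter.Eventually.of_forall fun _ => H.cost_bounded t ht _ (H.point_mem _ _ _))

theorem integrable_cost_point_mul_inner [IsProbabilityMeasure μ]
    (H : IsBGDData n K A f C D δ α) (hu : ∀ t, Measurable (u t)) (ν : ℝ) {t : ℕ} (ht : t < n)
    {z : Euc d} (hz : z ∈ K) :
    Integrable (fun ω => f t (bgdPoint K f ν δ α (fun s => u s ω) t) *
      inner ℝ (u t ω : Euc d) (bgdCentre K f ν δ α (fun s => u s ω) t - z)) μ := by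
  refine (H.integrable_cost_point hu ν ht).mul_bdd (c := D + D) ?_
    (Filter.Eventually.of_forall fun ω => ?_)
  · exact ((hu t).subtype_val.inner
      ((H.measurable_centre' hu ν ht.le).sub_const z)).aestronglyMeasurable
  · refine (norm_inner_le_norm _ _).trans ?_
    have h1 : ‖(u t ω : Euc d)‖ = 1 := by simp
    rw [h1, one_mul]
    exact (norm_sub_le _ _).trans
      (add_le_add (H.norm_le (H.smul_subset (H.centre_mem_smul _ _ _))) (H.norm_le hz))

/-- The expected one-period cost, corrected by the gradient estimate, is controlled by the cost of
any comparator. -/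
theorem integral_cost_point_le [IsProbabilityMeasure μ] (hd : 0 < d)
    (H : IsBGDData n K A f C D δ α) (hu : IsUniformDirections μ u) (ν : ℝ) {t : ℕ} (ht : t < n)
    {B : ℝ} (hB : ∀ y ∈ (1 - α) • K, ∀ v : UnitSphere d, f t (y + δ • (v : Euc d)) ≤ f t y + B)
    {z : Euc d} (hz : z ∈ K) :
    ∫ ω, f t (bgdPoint K f ν δ α (fun s => u s ω) t) ∂μ ≤ f t z + 2 * α * C + B +
      d / δ * ∫ ω, f t (bgdPoint K f ν δ α (fun s => u s ω) t) *
        inner ℝ (u t ω : Euc d) (bgdCentre K f ν δ α (fun s => u s ω) t - (1 - α) • z) ∂μ := by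
  have := isProbabilityMeasure_uniformSphere hd
  set z' := (1 - α) • z with hz'
  have hz'K : z' ∈ (1 - α) • K := smul_mem_smul_set hz
  -- With the centre frozen at `y`, the cost averages to at most `f t y + B`, and the correction to
  -- at most `f t z + 2 * α * C - f t y`; the unknown `f t y` cancels.
  set F : Euc d × UnitSphere d → ℝ := fun p => A.indicator (f t) (p.1 + δ • (p.2 : Euc d)) -
    d / δ * (A.indicator (f t) (p.1 + δ • (p.2 : Euc d)) *
      inner ℝ (p.2 : Euc d) (p.1 - z')) with hFdef
  have hFm : Measurable F := by
    have h1 : Measurable fun p : Euc d × UnitSphere d =>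
        A.indicator (f t) (p.1 + δ • (p.2 : Euc d)) :=
      (H.measurable_indicator ht).comp (by fun_prop)
    have h2 : Measurable fun p : Euc d × UnitSphere d => inner ℝ (p.2 : Euc d) (p.1 - z') :=
      Continuous.measurable (by fun_prop)
    exact h1.sub ((h1.mul h2).const_mul _)
  have hFe : ∀ y ∈ (1 - α) • K, ∀ v : UnitSphere d, F (y, v) = f t (y + δ • (v : Euc d)) -
      d / δ * (f t (y + δ • (v : Euc d)) * inner ℝ (v : Euc d) (y - z')) := fun y hy v => by
    simp only [hFdef,
      indicator_of_mem (H.played_subset y hy (H.add_smul_mem_closedBall y v)) (f t)]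
  have hi1 := H.integrable_cost_point (μ := μ) hu.measurable ν ht
  have hi2 := (H.integrable_cost_point_mul_inner (μ := μ) hu.measurable ν ht
    (H.smul_subset hz'K)).const_mul (d / δ)
  have hFω : ∀ ω, F (bgdCentre K f ν δ α (fun s => u s ω) t, u t ω) =
      f t (bgdPoint K f ν δ α (fun s => u s ω) t) -
      d / δ * (f t (bgdPoint K f ν δ α (fun s => u s ω) t) *
        inner ℝ (u t ω : Euc d) (bgdCentre K f ν δ α (fun s => u s ω) t - z')) := fun ω =>
    hFe _ (H.centre_mem_smul _ _ _) _
  have key := integral_le_of_indepFun (H.measurable_centre' hu.measurable ν ht.le)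
    (hu.measurable t) (hu.law t) (H.indepFun_centre hu ν ht.le) hFm
    (by simp only [hFω]; exact hi1.sub hi2) (c := f t z + 2 * α * C + B) ?_
  · simp only [hFω] at key
    rw [integral_sub hi1 hi2, integral_const_mul] at key
    linarith
  · intro ω
    set y := bgdCentre K f ν δ α (fun s => u s ω) t
    have hy : y ∈ (1 - α) • K := H.centre_mem_smul _ _ _
    have hcont : ContinuousOn (f t) (closedBall y δ) :=
      (H.cost_continuous t ht).mono (H.played_subset y hy)
    have hg := integral_uniformSphere_mul_inner_le hd H.delta_pos (H.cost_convex t ht)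
      (H.closedBall_delta_subset hy) (H.closedBall_delta_subset hz'K)
      (fun v hv => H.cost_le_of_mem_closedBall ht hz hv) hcont
    have hc1 : Continuous fun v : UnitSphere d => f t (y + δ • (v : Euc d)) :=
      hcont.comp_continuous (by fun_prop) (H.add_smul_mem_closedBall y)
    have hc2 : Continuous fun v : UnitSphere d =>
        d / δ * (f t (y + δ • (v : Euc d)) * inner ℝ (v : Euc d) (z' - y)) :=
      continuous_const.mul (hc1.mul (by fun_prop))
    have hint : ∀ G : UnitSphere d → ℝ, Continuous G → Integrable G (uniformSphere d) :=
      fun G hG => hG.integrable_of_hasCompactSupport (HasCompactSupport.of_compactSpace G)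
    simp only [hFe y hy]
    have e : ∀ v : UnitSphere d, inner ℝ (v : Euc d) (y - z') = -inner ℝ (v : Euc d) (z' - y) :=
      fun v => by rw [← inner_neg_right, neg_sub]
    simp only [e, mul_neg, sub_neg_eq_add]
    rw [integral_add (hint _ hc1) (hint _ hc2), integral_const_mul]
    have h1 : ∫ v : UnitSphere d, f t (y + δ • (v : Euc d)) ∂uniformSphere d ≤ f t y + B :=
      calc _ ≤ ∫ _, (f t y + B) ∂uniformSphere d :=
            integral_mono (hint _ hc1) (integrable_const _) (hB y hy)
        _ = _ := by simp
    linarith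

/-- The expected cost of bandit gradient descent against a fixed comparator. -/
theorem integral_sum_cost_le [IsProbabilityMeasure μ] (hd : 0 < d)
    (H : IsBGDData n K A f C D δ α) (hu : IsUniformDirections μ u) (hν : 0 < ν) {B : ℝ}
    (hB : ∀ t < n, ∀ y ∈ (1 - α) • K, ∀ v : UnitSphere d,
      f t (y + δ • (v : Euc d)) ≤ f t y + B) {z : Euc d} (hz : z ∈ K) :
    ∫ ω, ∑ t ∈ Finset.range n, f t (bgdPoint K f ν δ α (fun s => u s ω) t) ∂μ ≤
      ∑ t ∈ Finset.range n, f t z + (n * (2 * α * C + B) +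
        d / δ * ((D ^ 2 + n * (ν ^ 2 * C ^ 2)) / (2 * ν))) := by
  have hz' : (1 - α) • z ∈ (1 - α) • K := smul_mem_smul_set hz
  have hi := fun t (ht : t ∈ Finset.range n) => H.integrable_cost_point_mul_inner (μ := μ)
    hu.measurable ν (Finset.mem_range.1 ht) (H.smul_subset hz')
  rw [integral_finsetSum _ fun t ht =>
    H.integrable_cost_point hu.measurable ν (Finset.mem_range.1 ht)]
  have h1 := Finset.sum_le_sum fun t (ht : t ∈ Finset.range n) =>
    H.integral_cost_point_le hd hu ν (Finset.mem_range.1 ht) (hB t (Finset.mem_range.1 ht)) hz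
  refine h1.trans ?_
  simp only [Finset.sum_add_distrib, Finset.sum_const, Finset.card_range, nsmul_eq_mul]
  rw [← Finset.mul_sum, ← integral_finsetSum _ hi]
  have h2 : ∫ ω, ∑ t ∈ Finset.range n, f t (bgdPoint K f ν δ α (fun s => u s ω) t) *
      inner ℝ (u t ω : Euc d) (bgdCentre K f ν δ α (fun s => u s ω) t - (1 - α) • z) ∂μ ≤
      (D ^ 2 + n * (ν ^ 2 * C ^ 2)) / (2 * ν) := by
    calc _ ≤ ∫ _, (D ^ 2 + n * (ν ^ 2 * C ^ 2)) / (2 * ν) ∂μ := by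
          refine integral_mono (integrable_finsetSum _ hi) (integrable_const _) fun ω => ?_
          rw [le_div_iff₀ (by positivity), mul_comm]
          exact H.sum_mul_inner_le ν (fun s => u s ω) hz'
      _ = _ := by simp
  have h3 : 0 ≤ (d : ℝ) / δ := div_nonneg (Nat.cast_nonneg d) H.delta_pos.le
  have := mul_le_mul_of_nonneg_left h2 h3
  linarith

end Random

end IsBGDData

/-! ### From the reshaped problem back to `S` -/

section Reshaping

variable {d n : ℕ} {C R : ℝ} {S : Set (Euc d)} {T : Euc d ≃ᵃ[ℝ] Euc d} {c : ℕ → Euc d → ℝ}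

theorem image_eq_preimage_symm (T : Euc d ≃ᵃ[ℝ] Euc d) (S : Set (Euc d)) :
    T '' S = T.symm ⁻¹' S := T.toEquiv.image_eq_preimage_symm S

theorem continuous_symm (T : Euc d ≃ᵃ[ℝ] Euc d) : Continuous T.symm :=
  T.symm.toAffineMap.continuous_of_finiteDimensional

/-- The inverse of a map into near-isotropic position is Lipschitz with the radius of the
original set as constant. -/
theorem norm_symm_sub_symm_le (hS : S ⊆ closedBall 0 R) (hT : closedBall 0 1 ⊆ T '' S)
    (x y : Euc d) : ‖T.symm x - T.symm y‖ ≤ R * ‖x - y‖ := by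
  have hlin : ∀ a b : Euc d, T.symm a - T.symm b = T.symm.linear (a - b) := fun a b => by
    simpa using (T.symm.toAffineMap.linearMap_vsub a b).symm
  have h1 : ∀ v ∈ closedBall (0 : Euc d) 1, ‖T.symm.linear v‖ ≤ R := by
    intro v hv
    have hn : ∀ w ∈ closedBall (0 : Euc d) 1, ‖T.symm w‖ ≤ R := fun w hw => by
      have := hT hw
      rw [image_eq_preimage_symm] at this
      simpa using hS this
    -- Comparing antipodal points doubles the linear part, so the Lipschitz constant is `R` rather
    -- than `2 * R`.
    have h2 : T.symm v - T.symm (-v) = (2 : ℝ) • T.symm.linear v := by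
      rw [hlin, ← map_smul]
      congr 1
      module
    have h3 := norm_sub_le (T.symm v) (T.symm (-v))
    rw [h2, norm_smul, Real.norm_of_nonneg (by norm_num)] at h3
    linarith [hn v hv, hn (-v) (by simpa using hv)]
  rw [hlin]
  by_cases hxy : x - y = 0
  · simp [hxy]
  have hpos := norm_pos_iff.2 hxy
  have h4 := h1 (‖x - y‖⁻¹ • (x - y)) (by simp [norm_smul, hpos.ne'])
  rw [map_smul, norm_smul, norm_inv, norm_norm, inv_mul_le_iff₀ hpos] at h4
  linarith

theorem IsInstance.isClosed_image (h : IsInstance n C R S T c) : IsClosed (T '' S) := by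
  rw [image_eq_preimage_symm]
  exact h.closed.preimage (continuous_symm T)

theorem IsInstance.convex_image (h : IsInstance n C R S T c) : Convex ℝ (T '' S) :=
  h.convex.affine_image T.toAffineMap

theorem IsInstance.isBGDData (h : IsInstance n C R S T c) {A : Set (Euc d)} {δ α : ℝ}
    (hA : MeasurableSet A) (hcont : ∀ t < n, ContinuousOn (fun z => c t (T.symm z)) A)
    (hδ : 0 < δ) (hδα : δ ≤ α) (hα : α ≤ 1)
    (hplay : ∀ y ∈ (1 - α) • (T '' S), closedBall y δ ⊆ A) :
    IsBGDData n (T '' S) A (fun t z => c t (T.symm z)) C (1.01 * (d : ℝ)) δ α where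
  closed := h.isClosed_image
  convex := h.convex_image
  ball_subset := h.nearIsotropic.1
  subset_ball := h.nearIsotropic.2
  cost_convex t ht := by
    rw [image_eq_preimage_symm]
    exact (h.cost_convex t ht).comp_affineMap T.symm.toAffineMap
  cost_bounded t ht x hx := by
    rw [image_eq_preimage_symm] at hx
    exact abs_le.2 (h.cost_bounded t ht _ hx)
  measurableSet := hA
  cost_continuous := hcont
  delta_pos := hδ
  delta_le := hδα
  alpha_le := hα
  played_subset := hplay

/-- Lipschitz costs: points on the boundary may be played. -/
theorem IsInstance.isBGDData_of_lipschitz (h : IsInstance n C R S T c) {L : ℝ≥0}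
    (hL : ∀ t < n, LipschitzOnWith L (c t) S) {δ α : ℝ} (hδ : 0 < δ) (hδα : δ ≤ α) (hα : α ≤ 1) :
    IsBGDData n (T '' S) (T '' S) (fun t z => c t (T.symm z)) C (1.01 * (d : ℝ)) δ α := by
  refine h.isBGDData h.isClosed_image.measurableSet (fun t ht => ?_) hδ hδα hα fun y hy =>
    (closedBall_subset_closedBall hδα).trans (closedBall_subset_of_mem_smul h.convex_image
      h.nearIsotropic.1 (hδ.trans_le hδα) hα hy)
  refine (hL t ht).continuousOn.comp (continuous_symm T).continuousOn fun z hz => ?_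
  rwa [image_eq_preimage_symm] at hz

/-- General convex costs: only interior points are played. -/
theorem IsInstance.isBGDData_interior (h : IsInstance n C R S T c) {δ α : ℝ} (hδ : 0 < δ)
    (hδα : δ < α) (hα : α ≤ 1) :
    IsBGDData n (T '' S) (interior (T '' S)) (fun t z => c t (T.symm z)) C
      (1.01 * (d : ℝ)) δ α := by
  refine h.isBGDData measurableSet_interior (fun t ht => ?_) hδ hδα.le hα fun y hy =>
    (closedBall_subset_ball hδα).trans (interior_maximal (ball_subset_closedBall.trans
      (closedBall_subset_of_mem_smul h.convex_image h.nearIsotropic.1 (hδ.trans hδα) hα hy))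
      isOpen_ball)
  refine ConvexOn.continuousOn_interior ?_
  rw [image_eq_preimage_symm]
  exact (h.cost_convex t ht).comp_affineMap T.symm.toAffineMap

theorem IsInstance.nonempty (h : IsInstance n C R S T c) : S.Nonempty := by
  obtain ⟨x, hx, -⟩ := h.nearIsotropic.1 (mem_closedBall_self zero_le_one)
  exact ⟨x, hx⟩

variable {Ω : Type*} [MeasurableSpace Ω] {μ : Measure Ω} [IsProbabilityMeasure μ]
  {u : ℕ → Ω → UnitSphere d} {A : Set (Euc d)} {D ν δ α b : ℝ}

theorem IsInstance.hasRegretBound_of_forall (h : IsInstance n C R S T c)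
    (H : IsBGDData n (T '' S) A (fun t z => c t (T.symm z)) C D δ α)
    (hu : IsUniformDirections μ u)
    (hb : ∀ z ∈ S, ∫ ω, ∑ t ∈ Finset.range n,
      c t (reshapedPoint T S c ν δ α (fun s => u s ω) t) ∂μ ≤ ∑ t ∈ Finset.range n, c t z + b) :
    HasRegretBound μ u n S T c ν δ α b := by
  refine ⟨fun t _ ω => ?_, fun t ht => H.integrable_cost_point hu.measurable ν ht, ?_⟩
  · obtain ⟨x, hx, e⟩ := H.point_mem ν (fun s => u s ω) t
    rwa [reshapedPoint, ← e, AffineEquiv.symm_apply_apply]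
  · rw [expectedRegret, sub_le_comm]
    refine le_csInf (h.nonempty.image _) ?_
    rintro _ ⟨z, hz, rfl⟩
    exact sub_le_iff_le_add.2 (hb z hz)

theorem IsInstance.hasRegretBound (hd : 0 < d) (h : IsInstance n C R S T c)
    (H : IsBGDData n (T '' S) A (fun t z => c t (T.symm z)) C D δ α)
    (hu : IsUniformDirections μ u) (hν : 0 < ν) {B : ℝ}
    (hB : ∀ t < n, ∀ y ∈ (1 - α) • (T '' S), ∀ v : UnitSphere d,
      c t (T.symm (y + δ • (v : Euc d))) ≤ c t (T.symm y) + B)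
    (hb : n * (2 * α * C + B) + d / δ * ((D ^ 2 + n * (ν ^ 2 * C ^ 2)) / (2 * ν)) ≤ b) :
    HasRegretBound μ u n S T c ν δ α b := by
  refine h.hasRegretBound_of_forall H hu fun z hz => ?_
  have := H.integral_sum_cost_le (μ := μ) hd hu hν hB (mem_image_of_mem T hz)
  simp only [AffineEquiv.symm_apply_apply] at this
  exact this.trans (add_le_add_right hb _)

/-- The trivial regret bound for costs in `[-C, C]`. -/
theorem IsInstance.hasRegretBound_trivial (h : IsInstance n C R S T c)
    (H : IsBGDData n (T '' S) A (fun t z => c t (T.symm z)) C D δ α)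
    (hu : IsUniformDirections μ u) (hb : 2 * n * C ≤ b) :
    HasRegretBound μ u n S T c ν δ α b := by
  refine h.hasRegretBound_of_forall H hu fun z hz => ?_
  have hi : ∀ t ∈ Finset.range n, Integrable (fun ω =>
      c t (reshapedPoint T S c ν δ α (fun s => u s ω) t)) μ := fun t ht =>
    H.integrable_cost_point hu.measurable ν (Finset.mem_range.1 ht)
  have h1 : ∫ ω, ∑ t ∈ Finset.range n, c t (reshapedPoint T S c ν δ α (fun s => u s ω) t) ∂μ ≤
      n * C :=
    calc _ ≤ ∫ _, n * C ∂μ := by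
          refine integral_mono (integrable_finsetSum _ hi) (integrable_const _) fun ω => ?_
          have := Finset.sum_le_card_nsmul (Finset.range n)
            (fun t => c t (reshapedPoint T S c ν δ α (fun s => u s ω) t)) C fun t ht =>
              (abs_le.1 (H.cost_bounded t (Finset.mem_range.1 ht) _ (H.point_mem ν _ t))).2
          simpa using this
      _ = _ := by simp
  have h2 := Finset.card_nsmul_le_sum (Finset.range n) (fun t => c t z) (-C) fun t ht =>
    (h.cost_bounded t (Finset.mem_range.1 ht) z hz).1
  simp only [Finset.card_range, nsmul_eq_mul] at h2
  linarith

/-- The local oscillation of Lipschitz costs after reshaping. -/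
theorem IsInstance.cost_le_of_lipschitz (h : IsInstance n C R S T c) {L : ℝ≥0}
    (hL : ∀ t < n, LipschitzOnWith L (c t) S)
    (H : IsBGDData n (T '' S) A (fun t z => c t (T.symm z)) C D δ α) {t : ℕ} (ht : t < n)
    {y : Euc d} (hy : y ∈ (1 - α) • (T '' S)) (v : UnitSphere d) :
    c t (T.symm (y + δ • (v : Euc d))) ≤ c t (T.symm y) + δ * (L * R) := by
  have h1 := H.closedBall_delta_subset hy (H.add_smul_mem_closedBall y v)
  have h2 := H.smul_subset hy
  rw [image_eq_preimage_symm] at h1 h2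
  have h3 := (hL t ht).norm_sub_le h1 h2
  have h4 := norm_symm_sub_symm_le h.subset_ball h.nearIsotropic.1 (y + δ • (v : Euc d)) y
  have h5 : ‖(v : Euc d)‖ = 1 := by simp
  rw [add_sub_cancel_left, norm_smul, h5, mul_one, Real.norm_of_nonneg H.delta_pos.le] at h4
  have h6 := mul_le_mul_of_nonneg_left h4 L.2
  have h7 := le_abs_self (c t (T.symm (y + δ • (v : Euc d))) - c t (T.symm y))
  rw [Real.norm_eq_abs] at h3
  simp only [NNReal.val_eq_coe] at h6
  linarith

end Reshaping

/-- The local oscillation of bounded convex costs around shrunk points. -/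
theorem IsBGDData.cost_le {d n : ℕ} {K A : Set (Euc d)} {f : ℕ → Euc d → ℝ} {C D δ α : ℝ}
    (H : IsBGDData n K A f C D δ α) {t : ℕ} (ht : t < n) {y : Euc d} (hy : y ∈ (1 - α) • K)
    (v : UnitSphere d) : f t (y + δ • (v : Euc d)) ≤ f t y + 2 * C * (δ / α) := by
  have hα := H.alpha_pos
  have hv : y + α • (v : Euc d) ∈ K := by
    refine closedBall_subset_of_mem_smul H.convex H.ball_subset hα H.alpha_le hy ?_
    simp [norm_smul, abs_of_pos hα]
  have hr : δ / α ≤ 1 := (div_le_one hα).2 H.delta_le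
  have hr0 : 0 ≤ δ / α := div_nonneg H.delta_pos.le hα.le
  have hyK := H.smul_subset hy
  have h1 := (H.cost_convex t ht).2 hyK hv (sub_nonneg.2 hr) hr0 (by ring)
  -- The perturbed point lies on the segment from `y` to `y + α • v`, which is still in `K`.
  have e : (1 - δ / α) • y + (δ / α) • (y + α • (v : Euc d)) = y + δ • (v : Euc d) := by
    rw [smul_add, smul_smul, div_mul_cancel₀ _ hα.ne']
    module
  rw [e, smul_eq_mul, smul_eq_mul] at h1
  have h2 := (abs_le.1 (H.cost_bounded t ht _ hv)).2
  have h3 := (abs_le.1 (H.cost_bounded t ht _ hyK)).1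
  nlinarith

/-! ### Numerical bounds for the chosen parameters -/

section Parameters

theorem rpow_natCast_div_eq {x : ℝ} (hx : 0 ≤ x) (k m : ℕ) :
    x ^ ((k : ℝ) / m) = (x ^ (1 / (m : ℝ))) ^ k := by
  rw [← Real.rpow_natCast, ← Real.rpow_mul hx]
  congr 1
  ring

theorem rpow_one_div_natCast_pow {x : ℝ} (hx : 0 ≤ x) {m : ℕ} (hm : m ≠ 0) :
    (x ^ (1 / (m : ℝ))) ^ m = x := by
  rw [one_div, Real.rpow_inv_natCast_pow hx hm]

/-- The bound for the step `D / (C √n)`. -/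
theorem step_bound {C D : ℝ} {r : ℝ} (hC : 0 < C) (hD : 0 < D) (hr : 0 < r) :
    (D ^ 2 + r ^ 2 * ((D / (C * r)) ^ 2 * C ^ 2)) / (2 * (D / (C * r))) = D * C * r := by
  field_simp
  ring

/-- With `s ^ 4 = n`, this `δ` equates `3 (L' + C) n δ`, which dominates the first term, with the
second term. The final comparison of squares has room because `1.01 / 3 < 1`. -/
theorem lipschitz_bound {s q d C L' : ℝ} (hs : 0 < s) (hd : 0 < d) (hC : 0 < C) (hL : 0 ≤ L')
    (hq : q = 1.01 * d ^ 2 * C / (3 * (L' + C))) {δ : ℝ} (hδ : δ = √q / s) :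
    s ^ 4 * (2 * δ * C + δ * L') + d / δ * (1.01 * d * C * s ^ 2) ≤
      6 * s ^ 3 * d * (√(C * L') + C) := by
  have hP : 0 < L' + C := by linarith
  have hq0 : 0 < q := by rw [hq]; positivity
  have hsq : 0 < √q := Real.sqrt_pos.2 hq0
  have hqq : √q ^ 2 = q := Real.sq_sqrt hq0.le
  have hqP : q * (3 * (L' + C)) = 1.01 * d ^ 2 * C := by
    rw [hq, div_mul_cancel₀]; positivity
  have h1 : d / δ * (1.01 * d * C * s ^ 2) = 3 * s ^ 3 * √q * (L' + C) := by
    have : 1.01 * d ^ 2 * C = √q ^ 2 * (3 * (L' + C)) := by rw [hqq, hqP]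
    rw [hδ]
    field_simp
    linear_combination this
  have h2 : s ^ 4 * (2 * δ * C + δ * L') ≤ 3 * s ^ 3 * √q * (L' + C) := by
    have : s ^ 4 * (2 * δ * C + δ * L') = s ^ 3 * √q * (2 * C + L') := by
      rw [hδ]; field_simp
    rw [this]
    have : 0 < s ^ 3 * √q := by positivity
    nlinarith
  have hX : √(C * L') ^ 2 = C * L' := Real.sq_sqrt (by positivity)
  have hX0 := Real.sqrt_nonneg (C * L')
  have h3 : √q * (L' + C) ≤ d * (√(C * L') + C) := by
    refine le_of_pow_le_pow_left₀ two_ne_zero (by positivity) ?_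
    have e1 : (√q * (L' + C)) ^ 2 = 1.01 / 3 * d ^ 2 * (C * L' + C ^ 2) := by
      rw [mul_pow, hqq]; linear_combination (L' + C) / 3 * hqP
    have e2 : (d * (√(C * L') + C)) ^ 2 = d ^ 2 * (C * L' + 2 * √(C * L') * C + C ^ 2) := by
      rw [mul_pow]; linear_combination d ^ 2 * hX
    rw [e1, e2]
    have : 0 ≤ d ^ 2 * (C * L' + C ^ 2) := by positivity
    have : 0 ≤ d ^ 2 * (√(C * L') * C) := by positivity
    nlinarith
  have h4 := mul_le_mul_of_nonneg_left h3 (by positivity : 0 ≤ 6 * s ^ 3)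
  linarith

/-- With `s ^ 6 = n` and `δ = α ^ 2 / 3`, the gradient term equals `2 C α n` and the others add up
to `8 / 3 * C α n`. The total `14 / 3 * C α n` meets the constant `6` through `α s ≤ 9 / 7 * d`. -/
theorem general_bound {s d C α : ℝ} (hs : 0 < s) (hd : 1 ≤ d) (hC : 0 < C) (hα : 0 < α)
    (hα3 : (α * s) ^ 3 = 3 * (1.01 * d) * d / 2) :
    s ^ 6 * (2 * α * C + 2 * C * (α ^ 2 / 3 / α)) + d / (α ^ 2 / 3) * (1.01 * d * C * s ^ 3) ≤
      6 * s ^ 5 * d * C := by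
  have h1 : d / (α ^ 2 / 3) * (1.01 * d * C * s ^ 3) = 2 * C * α * s ^ 6 := by
    field_simp
    linear_combination -2 * hα3
  have h2 : s ^ 6 * (2 * α * C + 2 * C * (α ^ 2 / 3 / α)) = s ^ 6 * (8 / 3 * α * C) := by
    field_simp
    ring
  have h3 : α * s ≤ 9 / 7 * d := by
    refine le_of_pow_le_pow_left₀ three_ne_zero (by positivity) ?_
    rw [hα3]
    have : d ^ 2 ≤ d ^ 3 := pow_le_pow_right₀ hd (by norm_num)
    nlinarith
  have h4 := mul_le_mul_of_nonneg_left h3 (by positivity : 0 ≤ 14 / 3 * s ^ 5 * C)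
  rw [h1, h2]
  linarith

end Parameters

/-! ### Large and small horizons -/

theorem mainTheorem3 (d n : ℕ) (hd : 0 < d) (hn : 0 < n) (C R : ℝ) (hC : 0 < C) (hR : 0 < R) :
    -- Lipschitz costs
    (∀ L : ℝ≥0, ∃ ν δ α : ℝ, 0 < ν ∧ 0 < δ ∧ 0 ≤ α ∧ α ≤ 1 ∧
      ((1.01 * (d : ℝ) ^ 2 * C / (3 * (L * R + C))) ^ 2 ≤ (n : ℝ) →
        ν = 1.01 * (d : ℝ) / (C * √(n : ℝ)) ∧
        δ = (n : ℝ) ^ (-(1 / 4) : ℝ) * √(1.01 * (d : ℝ) ^ 2 * C / (3 * (L * R + C))) ∧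
        α = δ) ∧
      ∀ (S : Set (Euc d)) (T : Euc d ≃ᵃ[ℝ] Euc d) (c : ℕ → Euc d → ℝ),
        IsInstance n C R S T c →
        (∀ t < n, LipschitzOnWith L (c t) S) →
        ∀ (Ω : Type*) [MeasurableSpace Ω] (μ : Measure Ω) [IsProbabilityMeasure μ]
          (u : ℕ → Ω → UnitSphere d), IsUniformDirections μ u →
          HasRegretBound μ u n S T c ν δ α
            (6 * (n : ℝ) ^ (3 / 4 : ℝ) * d * (√(C * L * R) + C))) ∧
    -- no Lipschitz assumption
    (∃ ν δ α : ℝ, 0 < ν ∧ 0 < δ ∧ 0 ≤ α ∧ α ≤ 1 ∧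
      ((3 * (1.01 * (d : ℝ)) * d / 2) ^ 2 ≤ (n : ℝ) →
        ν = 1.01 * (d : ℝ) / (C * √(n : ℝ)) ∧
        δ = ((1.01 * (d : ℝ)) ^ 2 * (d : ℝ) ^ 2 / (12 * (n : ℝ))) ^ (1 / 3 : ℝ) ∧
        α = (3 * (1.01 * (d : ℝ)) * d / (2 * √(n : ℝ))) ^ (1 / 3 : ℝ)) ∧
      ∀ (S : Set (Euc d)) (T : Euc d ≃ᵃ[ℝ] Euc d) (c : ℕ → Euc d → ℝ),
        IsInstance n C R S T c →
        ∀ (Ω : Type*) [MeasurableSpace Ω] (μ : Measure Ω) [IsProbabilityMeasure μ]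
          (u : ℕ → Ω → UnitSphere d), IsUniformDirections μ u →
          HasRegretBound μ u n S T c ν δ α (6 * (n : ℝ) ^ (5 / 6 : ℝ) * d * C)) := by
  have hd1 : (1 : ℝ) ≤ d := by exact_mod_cast hd
  have hd0 : (0 : ℝ) < d := by positivity
  have hn0 : (0 : ℝ) < n := by positivity
  constructor
  · intro L
    have hLR : 0 ≤ L * R := mul_nonneg L.2 hR.le
    obtain ⟨s, hs⟩ : ∃ s : ℝ, s = (n : ℝ) ^ (1 / ((4 : ℕ) : ℝ)) := ⟨_, rfl⟩
    have hs0 : 0 < s := by rw [hs]; positivity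
    have hs4 : s ^ 4 = n := by rw [hs]; exact rpow_one_div_natCast_pow hn0.le (by norm_num)
    have hs3 : (n : ℝ) ^ (3 / 4 : ℝ) = s ^ 3 := by
      rw [hs]; exact_mod_cast rpow_natCast_div_eq hn0.le 3 4
    have hsi : (n : ℝ) ^ (-(1 / 4) : ℝ) = s⁻¹ := by
      rw [Real.rpow_neg hn0.le, hs]; norm_num
    have hs2 : √(n : ℝ) = s ^ 2 := by
      rw [← hs4, show s ^ 4 = (s ^ 2) ^ 2 by ring, Real.sqrt_sq (by positivity)]
    obtain ⟨q, hq⟩ : ∃ q : ℝ, q = 1.01 * (d : ℝ) ^ 2 * C / (3 * (L * R + C)) := ⟨_, rfl⟩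
    have hq0 : 0 < q := by rw [hq]; positivity
    rw [← hq, hsi, hs2, hs3, mul_assoc C]
    by_cases hbig : q ^ 2 ≤ n
    · have hδ0 : 0 < √q / s := by positivity
      -- The threshold on `n` says exactly that `δ ≤ 1`.
      have hδ1 : √q / s ≤ 1 := by
        rw [div_le_one hs0]
        refine (Real.sqrt_le_left hs0.le).2 ?_
        rw [← hs4, show s ^ 4 = (s ^ 2) ^ 2 by ring] at hbig
        exact le_of_pow_le_pow_left₀ two_ne_zero (by positivity) hbig
      refine ⟨1.01 * d / (C * s ^ 2), √q / s, √q / s, by positivity, hδ0, hδ0.le, hδ1,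
        fun _ => ⟨rfl, by ring, rfl⟩, fun S T c h hL Ω _ μ _ u hu => ?_⟩
      have H := h.isBGDData_of_lipschitz hL hδ0 le_rfl hδ1
      refine h.hasRegretBound hd H hu (by positivity)
        (fun t ht y hy v => h.cost_le_of_lipschitz hL H ht hy v) ?_
      have e := step_bound hC (D := 1.01 * d) (by positivity) (r := s ^ 2) (by positivity)
      rw [← hs4, show s ^ 4 = (s ^ 2) ^ 2 by ring, e, show (s ^ 2) ^ 2 = s ^ 4 by ring]
      exact lipschitz_bound hs0 hd0 hC hLR hq rfl
    -- Below the threshold, `α = 1` shrinks the set to the origin, and `δ < 1` keeps every played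
    -- point in the interior. Here `s ≤ d`, so the trivial bound `2 * n * C` is enough.
    · refine ⟨1, 1 / 2, 1, by norm_num, by norm_num, by norm_num, by norm_num,
        fun h => absurd h hbig, fun S T c h _ Ω _ μ _ u hu => ?_⟩
      refine h.hasRegretBound_trivial
        (h.isBGDData_interior (by norm_num) (by norm_num) le_rfl) hu ?_
      rw [← hs4, show s ^ 4 = (s ^ 2) ^ 2 by ring] at hbig
      have h1 : s ^ 2 < q := lt_of_pow_lt_pow_left₀ 2 hq0.le (not_le.1 hbig)
      have h2 : q ≤ (d : ℝ) ^ 2 := by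
        rw [hq, div_le_iff₀ (by positivity)]
        have : 0 ≤ (d : ℝ) ^ 2 * (L * R) := by positivity
        have : 0 ≤ (d : ℝ) ^ 2 * C := by positivity
        nlinarith
      have h3 : s ≤ d := le_of_pow_le_pow_left₀ two_ne_zero hd0.le (h1.le.trans h2)
      have h4 := mul_le_mul_of_nonneg_left h3 (by positivity : 0 ≤ 2 * s ^ 3 * C)
      have h5 : 0 ≤ s ^ 3 * d * √(C * (L * R)) := by positivity
      have h6 : 0 ≤ s ^ 3 * d * C := by positivity
      rw [← hs4]
      linarith
  · obtain ⟨s, hs⟩ : ∃ s : ℝ, s = (n : ℝ) ^ (1 / ((6 : ℕ) : ℝ)) := ⟨_, rfl⟩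
    have hs0 : 0 < s := by rw [hs]; positivity
    have hs6 : s ^ 6 = n := by rw [hs]; exact rpow_one_div_natCast_pow hn0.le (by norm_num)
    have hs5 : (n : ℝ) ^ (5 / 6 : ℝ) = s ^ 5 := by
      rw [hs]; exact_mod_cast rpow_natCast_div_eq hn0.le 5 6
    have hs3 : √(n : ℝ) = s ^ 3 := by
      rw [← hs6, show s ^ 6 = (s ^ 3) ^ 2 by ring, Real.sqrt_sq (by positivity)]
    rw [hs5, hs3]
    by_cases hbig : (3 * (1.01 * (d : ℝ)) * d / 2) ^ 2 ≤ n
    · obtain ⟨α, hα⟩ : ∃ α : ℝ,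
        α = (3 * (1.01 * (d : ℝ)) * d / (2 * s ^ 3)) ^ (1 / ((3 : ℕ) : ℝ)) := ⟨_, rfl⟩
      have hα0 : 0 < α := by rw [hα]; positivity
      have hα3 : α ^ 3 = 3 * (1.01 * (d : ℝ)) * d / (2 * s ^ 3) := by
        rw [hα]; exact rpow_one_div_natCast_pow (by positivity) (by norm_num)
      have hαs : (α * s) ^ 3 = 3 * (1.01 * (d : ℝ)) * d / 2 := by
        rw [mul_pow, hα3]; field_simp
      -- Again this is the threshold on `n`; it also gives `δ < α`, which keeps play in the
      -- interior, where convex costs are continuous.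
      have hα1 : α ≤ 1 := by
        refine le_of_pow_le_pow_left₀ three_ne_zero zero_le_one ?_
        rw [hα3, one_pow, div_le_one (by positivity)]
        rw [← hs6, show s ^ 6 = (s ^ 3) ^ 2 by ring] at hbig
        linarith [le_of_pow_le_pow_left₀ two_ne_zero (by positivity) hbig]
      have hδ : α ^ 2 / 3 = ((1.01 * (d : ℝ)) ^ 2 * (d : ℝ) ^ 2 / (12 * (n : ℝ))) ^ (1 / 3 : ℝ) := by
        have e : (1.01 * (d : ℝ)) ^ 2 * (d : ℝ) ^ 2 / (12 * (n : ℝ)) = (α ^ 2 / 3) ^ 3 := by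
          have : (α ^ 2 / 3) ^ 3 = (α ^ 3) ^ 2 / 27 := by ring
          rw [this, hα3, ← hs6]
          field_simp
          ring
        rw [e, ← Real.rpow_natCast _ 3, ← Real.rpow_mul (by positivity)]
        norm_num
      have hδ0 : 0 < α ^ 2 / 3 := by positivity
      have hδα : α ^ 2 / 3 < α := by nlinarith
      refine ⟨1.01 * d / (C * s ^ 3), α ^ 2 / 3, α, by positivity, hδ0, hα0.le, hα1,
        fun _ => ⟨rfl, hδ, by exact_mod_cast hα⟩, fun S T c h Ω _ μ _ u hu => ?_⟩
      have H := h.isBGDData_interior hδ0 hδα hα1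
      refine h.hasRegretBound hd H hu (by positivity) (fun t ht y hy v => H.cost_le ht hy v) ?_
      have e := step_bound hC (D := 1.01 * d) (by positivity) (r := s ^ 3) (by positivity)
      rw [← hs6, show s ^ 6 = (s ^ 3) ^ 2 by ring, e, show (s ^ 3) ^ 2 = s ^ 6 by ring]
      exact general_bound hs0 hd1 hC hα0 hαs
    · refine ⟨1, 1 / 2, 1, by norm_num, by norm_num, by norm_num, by norm_num,
        fun h => absurd h hbig, fun S T c h Ω _ μ _ u hu => ?_⟩
      refine h.hasRegretBound_trivial
        (h.isBGDData_interior (by norm_num) (by norm_num) le_rfl) hu ?_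
      rw [← hs6, show s ^ 6 = (s ^ 3) ^ 2 by ring] at hbig
      have h1 : s ^ 3 < 3 * (1.01 * (d : ℝ)) * d / 2 :=
        lt_of_pow_lt_pow_left₀ 2 (by positivity) (not_le.1 hbig)
      have h2 : (d : ℝ) ^ 2 ≤ d ^ 3 := pow_le_pow_right₀ hd1 (by norm_num)
      -- The factor `3` is exactly what turns `2 * s ^ 6 * C` into `6 * s ^ 5 * d * C`.
      have h3 : s ≤ 3 * d := by
        refine le_of_pow_le_pow_left₀ three_ne_zero (by positivity) ?_
        nlinarith
      have h4 := mul_le_mul_of_nonneg_left h3 (by positivity : 0 ≤ 2 * s ^ 5 * C)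
      rw [← hs6]
      linarith
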